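/- Let $P$ be a partially ordered set and let $X$ be a $P$-stratified simplicial set, i.e. a simplicial set $X$ with a simplicial map $X\to N(P)$ to the nerve of $P$. Let $|X|$ be its stratified realization: the geometric realization with the continuous map $s\colon |X|\to P$ (where the closed subsets of $P$ are the downward closed ones) which on a simplex with flag $[q_0\le\dots\le q_m]$ is $x\mapsto\sup\{q_i : x_i>0\}$. For a subset $A$ of $|X|$ and $Q\subseteq P$ put $A_Q=A\cap s^{-1}(Q)$, and $A_{p}$, $A_{\le p}$, $A_{\ge p}$ for the evident $Q$. For $p\in P$ let $s_p$ and $s_{\not\le p}$ be the functions on $|X|$ given on such a simplex by $\sum_{q_i=p}x_i$ and $\sum_{q_i\not\le p}x_i$, and let $$U(p)=\{x\in|X| : s_{\not\le p}(x)\le s_p(x)\}$$ (the standard neighborhood system). For a regular flag $\mathcal I=[p_0<\dots<p_n]$ of $P$ let $U(\mathcal I)=\bigcap_{p\in\mathcal I}U(p)$, a $P$-stratified space by restriction of $s$, and let $\mathrm{HoLink}_{\mathcal I}(U(\mathcal I))$ be the space (compact-open topology) of continuous maps $\sigma\colon|\Delta^n|\to U(\mathcal I)$ with $s(\sigma(u))=\max\{p_i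 : u_i>0\}$ for all $u$. Then $(U(p))_{p\in P}$ is a homotopy link model for $|X|$. That is: 1. it is a strata-neighborhood system: for every $p$ one has $|X|_{\le p}\subseteq U(p)$, and for every flag $[q_0\le\dots\le q_m]$ of $P$ and every continuous $\sigma\colon|\Delta^m|\to|X|$ with $s(\sigma(u))=\max\{q_i : u_i>0\}$ for all $u$, the set $\sigma^{-1}(U(p))$ is a neighborhood of $\sigma^{-1}(|X|_p)$; 2. for every regular flag $\mathcal I=[p_0<\dots<p_n]$ of $P$, the evaluation at the last vertex $\mathrm{HoLink}_{\mathcal I}(U(\mathcal I))\to U(\mathcal I)_{p_n}$ and the inclusion $U(\mathcal I)_{p_n}\hookrightarrow U(\mathcal I)_{\ge p_n}$ are weak homotopy equivalences. This holds in each of the categories of all topological spaces, of compactly generated spaces, and of $\Delta$-generated spaces (in the last two cases subspaces and mapping spaces carry the correspondingly refined topologies). -/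

import Mathlib

universe u

open CategoryTheory Topology Opposite

namespace StratifiedLinks

noncomputable section

/-! ### Conventions on topological spaces -/

/-- The three categories of topological spaces in which one may work: all topological spaces,
compactly generated spaces, and Delta-generated spaces. -/
inductive SpaceConvention
  | general
  | compactlyGenerated
  | deltaGenerated

namespace SpaceConvention

variable (c : SpaceConvention)

/-- The set `X`, to be equipped with the topology of its coreflection into the category of spaces
chosen by `c`: the given topology, the final topology with respect to all continuous maps from
compact Hausdorff spaces, or the final topology with respect to all continuous maps from Euclidean
spaces (equivalently, from topological simplices). -/
@[nolint unusedArguments]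
def Refine (_c : SpaceConvention) (X : Type u) [TopologicalSpace X] : Type u := X

instance refineTopology (X : Type u) [t : TopologicalSpace X] : TopologicalSpace (c.Refine X) :=
  match c with
  | general => t
  | compactlyGenerated => TopologicalSpace.compactlyGenerated.{u, u} X
  | deltaGenerated => TopologicalSpace.generatedBy (fun n : ℕ => Fin n → ℝ) (Y := X)

/-- The identity map from the coreflection to the original space. -/
def ofRefine {X : Type u} [TopologicalSpace X] (x : c.Refine X) : X := x

/-- The identity map from the original space to its coreflection (usually not continuous). -/
def toRefine {X : Type u} [TopologicalSpace X] (x : X) : c.Refine X := x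

lemma continuous_ofRefine (X : Type u) [TopologicalSpace X] :
    Continuous (c.ofRefine (X := X)) := by
  cases c with
  | general => exact continuous_id
  | compactlyGenerated =>
    exact _root_.continuous_from_compactlyGenerated (X := X) (Y := X) id
      (fun S g => g.continuous)
  | deltaGenerated =>
    exact WithGeneratedByTopology.continuous_equiv (X := fun n : ℕ => Fin n → ℝ) (Y := X)

/-- A continuous map stays continuous after passing to coreflections. -/
def refineMap {X Y : Type u} [TopologicalSpace X] [TopologicalSpace Y] (f : C(X, Y)) :
    C(c.Refine X, c.Refine Y) where
  toFun x := c.toRefine (f (c.ofRefine x))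
  continuous_toFun := by
    cases c with
    | general => exact f.continuous
    | compactlyGenerated =>
      refine _root_.continuous_from_compactlyGenerated (X := X)
        (Y := SpaceConvention.compactlyGenerated.Refine Y) f fun S g => ?_
      let F : (Σ (i : (S : CompHaus.{u}) × C(S, Y)), i.fst) →
        SpaceConvention.compactlyGenerated.Refine Y := fun a => a.1.2 a.2
      have hF : Continuous F := continuous_coinduced_rng
      exact hF.comp (continuous_sigmaMk (σ := fun i : (S : CompHaus.{u}) × C(S, Y) => i.fst)
        (i := ⟨S, f.comp g⟩))
    | deltaGenerated =>
      refine (WithGeneratedByTopology.continuous_from_iff (X := fun n : ℕ => Fin n → ℝ) (Y := X)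
        (Z := WithGeneratedByTopology (fun n : ℕ => Fin n → ℝ) Y) f).2 fun n g => ?_
      exact continuous_iff_coinduced_le.2 (le_iSup₂_of_le (f := fun (i : ℕ) (h : C(Fin i → ℝ, Y)) =>
        TopologicalSpace.coinduced h inferInstance) n (f.comp g) le_rfl)

end SpaceConvention

/-! ### Weak homotopy equivalences -/

/-- The map induced by a continuous map on sets of path components. -/
def zerothHomotopyMap {X Y : Type u} [TopologicalSpace X] [TopologicalSpace Y] (f : C(X, Y)) :
    ZerothHomotopy X → ZerothHomotopy Y :=
  Quotient.map f (fun _ _ h => h.map f.continuous)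

/-- The map induced by a continuous map on based `n`-dimensional loops. -/
def genLoopMap {X Y : Type u} [TopologicalSpace X] [TopologicalSpace Y] (f : C(X, Y))
    (n : ℕ) (x : X) (γ : GenLoop (Fin n) X x) : GenLoop (Fin n) Y (f x) :=
  ⟨f.comp γ.1, fun y hy => congrArg f (γ.2 y hy)⟩

/-- The map induced by a continuous map on homotopy groups. -/
def homotopyGroupMap {X Y : Type u} [TopologicalSpace X] [TopologicalSpace Y] (f : C(X, Y))
    (n : ℕ) (x : X) : HomotopyGroup.Pi n X x → HomotopyGroup.Pi n Y (f x) :=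
  Quotient.map (genLoopMap f n x) (fun _ _ h => ContinuousMap.HomotopicRel.comp_continuousMap h f)

/-- Weak equivalences of topological spaces: bijective on path components and on all homotopy
groups in positive degrees, for all base points. -/
def IsWeakEquivalence {X Y : Type u} [TopologicalSpace X] [TopologicalSpace Y]
    (f : C(X, Y)) : Prop :=
  Function.Bijective (zerothHomotopyMap f) ∧
    ∀ (n : ℕ) (x : X), Function.Bijective (homotopyGroupMap f (n + 1) x)

/-! ### Stratified simplices -/

section Simplex

variable {P : Type u} [PartialOrder P] {n : ℕ}

lemma support_nonempty (x : stdSimplex ℝ (Fin (n + 1))) :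
    (Finset.univ.filter fun i => 0 < x i).Nonempty := by
  by_contra h
  rw [Finset.not_nonempty_iff_eq_empty, Finset.filter_eq_empty_iff] at h
  have h0 : ∀ i, x i = 0 := fun i =>
    le_antisymm (not_lt.1 (h (Finset.mem_univ i))) (stdSimplex.zero_le x i)
  have h1 := stdSimplex.sum_eq_one x
  simp [h0] at h1

/-- The stratum of a point `x` in the realization of the stratified simplex of the flag `J`. -/
def simplexStratum (J : Fin (n + 1) →o P) (x : stdSimplex ℝ (Fin (n + 1))) : P :=
  J ((Finset.univ.filter fun i => 0 < x i).max' (support_nonempty x))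

/-- The stratum of `x` is the greatest element, hence the supremum, of the `J i` with
`0 < x i`. -/
lemma isGreatest_simplexStratum (J : Fin (n + 1) →o P) (x : stdSimplex ℝ (Fin (n + 1))) :
    IsGreatest {p | ∃ i, 0 < x i ∧ J i = p} (simplexStratum J x) := by
  refine ⟨⟨_, (Finset.mem_filter.1 (Finset.max'_mem _ (support_nonempty x))).2, rfl⟩, ?_⟩
  rintro _ ⟨i, hi, rfl⟩
  exact J.monotone (Finset.le_max' _ _ (by simp [hi]))

/-- The stratification of the topological simplex, as a continuous map to the Alexandrov space of
`P` (whose closed sets are the downward closed sets). -/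
def simplexStratification (J : Fin (n + 1) →o P) :
    C(stdSimplex ℝ (Fin (n + 1)), WithUpperSet P) where
  toFun x := WithUpperSet.toUpperSet (simplexStratum J x)
  continuous_toFun := by
    rw [continuous_def]
    intro U hU
    rw [IsUpperSet.isOpen_iff_isUpperSet] at hU
    have h : (fun x => WithUpperSet.toUpperSet (simplexStratum J x)) ⁻¹' U =
        ⋃ i, ⋃ (_ : WithUpperSet.toUpperSet (J i) ∈ U),
          {x : stdSimplex ℝ (Fin (n + 1)) | 0 < x i} := by
      ext x
      simp only [Set.mem_preimage, Set.mem_iUnion]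
      constructor
      · intro hx
        obtain ⟨i, hi, hJ⟩ := (isGreatest_simplexStratum J x).1
        exact ⟨i, by rwa [hJ], hi⟩
      · rintro ⟨i, hi, hx⟩
        exact hU ((isGreatest_simplexStratum J x).2 ⟨i, hx, rfl⟩) hi
    rw [h]
    refine isOpen_iUnion fun i => isOpen_iUnion fun _ => ?_
    exact isOpen_lt continuous_const ((continuous_apply i).comp continuous_subtype_val)

lemma map_pos_iff {m : ℕ} (f : Fin (m + 1) → Fin (n + 1)) (x : stdSimplex ℝ (Fin (m + 1)))
    (i : Fin (n + 1)) : 0 < stdSimplex.map f x i ↔ ∃ j, 0 < x j ∧ f j = i := by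
  classical
  rw [stdSimplex.map_coe, FunOnFinite.linearMap_apply_apply,
    Finset.sum_pos_iff_of_nonneg (fun j _ => stdSimplex.zero_le x j)]
  simp [and_comm]

lemma simplexStratum_map {m : ℕ} (J : Fin (n + 1) →o P) (f : Fin (m + 1) →o Fin (n + 1))
    (x : stdSimplex ℝ (Fin (m + 1))) :
    simplexStratum J (stdSimplex.map f x) = simplexStratum (J.comp f) x := by
  refine (isGreatest_simplexStratum J _).unique ?_
  convert isGreatest_simplexStratum (J.comp f) x using 1
  ext p
  simp only [map_pos_iff, Set.mem_ofPred_eq]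
  constructor
  · rintro ⟨_, ⟨j, hj, rfl⟩, rfl⟩
    exact ⟨j, hj, rfl⟩
  · rintro ⟨j, hj, rfl⟩
    exact ⟨_, ⟨j, hj, rfl⟩, rfl⟩

/-- The sum of those coordinates of `x` whose entry in the flag `J` lies in `Q`. -/
def simplexMass (J : Fin (n + 1) →o P) (Q : Set P) : C(stdSimplex ℝ (Fin (n + 1)), ℝ) where
  toFun x := open Classical in ∑ i, if J i ∈ Q then x i else 0
  continuous_toFun := by
    classical
    refine continuous_finsetSum _ fun i _ => ?_
    split_ifs
    · exact (continuous_apply i).comp continuous_subtype_val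
    · exact continuous_const

lemma simplexMass_map {m : ℕ} (J : Fin (n + 1) →o P) (Q : Set P)
    (f : Fin (m + 1) →o Fin (n + 1)) (x : stdSimplex ℝ (Fin (m + 1))) :
    simplexMass J Q (stdSimplex.map f x) = simplexMass (J.comp f) Q x := by
  classical
  have h : ∀ i, (if J i ∈ Q then stdSimplex.map f x i else 0) =
      ∑ j with f j = i, if J (f j) ∈ Q then x j else 0 := by
    intro i
    rw [stdSimplex.map_coe, FunOnFinite.linearMap_apply_apply, Finset.sum_filter,
      Finset.sum_filter]
    split_ifs with hi
    · refine Finset.sum_congr rfl fun j _ => ?_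
      split_ifs with h1 h2
      · rfl
      · exact absurd (h1 ▸ hi) h2
      · rfl
    · refine (Finset.sum_eq_zero fun j _ => ?_).symm
      split_ifs with h1 h2
      · exact absurd (h1 ▸ h2) hi
      · rfl
      · rfl
  change ∑ i, (if J i ∈ Q then stdSimplex.map f x i else 0) =
    ∑ j, (if J (f j) ∈ Q then x j else 0)
  simp_rw [h]
  exact Finset.sum_fiberwise Finset.univ f _

end Simplex

/-! ### Stratified spaces and stratified simplicial sets -/

section Stratified

variable (P : Type u) [PartialOrder P]

/-- `P`-stratified spaces: spaces over the Alexandrov space of `P`. -/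
abbrev StratTop := Over (TopCat.of (WithUpperSet P))

/-- `P`-stratified simplicial sets: simplicial sets over the nerve of `P`. -/
abbrev StratSSet := Over (nerve P)

/-- The flag of `P` underlying a simplex of the nerve. -/
def nerveFlag {P : Type u} [PartialOrder P] {n : ℕ} (J : ComposableArrows P n) :
    Fin (n + 1) →o P := ⟨J.obj, fun _ _ h => leOfHom (J.map (homOfLE h))⟩

/-- The map from the nerve of `P` to the singular simplicial set of the Alexandrov space of `P`,
sending a flag to the stratification of the corresponding topological simplex. -/
def nerveToSing : nerve P ⟶ TopCat.toSSet.obj (TopCat.of (WithUpperSet P)) where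
  app n := TypeCat.ofHom fun J => (TopCat.toSSetObjEquiv (TopCat.of (WithUpperSet P)) n).symm
    (simplexStratification (P := P) (nerveFlag J))
  naturality := by
    intro m n f
    ext J
    apply (TopCat.toSSetObjEquiv (TopCat.of (WithUpperSet P)) n).injective
    ext x
    exact (simplexStratum_map (nerveFlag J) f.unop.toOrderHom x).symm

/-- The stratified realization functor: `X → nerve P` is sent to the composite
`|X| → |nerve P| → P`, where the second map is the stratification `x ↦ sup {p_i | 0 < x_i}` on
each simplex. -/
def realization : StratSSet P ⥤ StratTop P :=
  Over.post SSet.toTop ⋙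
    Over.map ((sSetTopAdj.homEquiv _ (TopCat.of (WithUpperSet P))).symm (nerveToSing P))

/-- The map from the nerve of `P` to the singular simplicial set of the real line, given by
`simplexMass` on simplices. -/
def nerveMass (Q : Set P) : nerve P ⟶ TopCat.toSSet.obj (TopCat.of (ULift.{u} ℝ)) where
  app n := TypeCat.ofHom fun J => (TopCat.toSSetObjEquiv (TopCat.of (ULift.{u} ℝ)) n).symm
    ⟨fun x => ULift.up (simplexMass (nerveFlag J) Q x),
      continuous_uliftUp.comp (simplexMass (nerveFlag J) Q).continuous⟩
  naturality := by
    intro m n f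
    ext J
    apply (TopCat.toSSetObjEquiv (TopCat.of (ULift.{u} ℝ)) n).injective
    ext x
    exact (simplexMass_map (nerveFlag J) Q f.unop.toOrderHom x).symm

variable {P}

/-- The coordinate `s_Q` on the realization of a stratified simplicial set: on each simplex it is
the sum of the barycentric coordinates of the vertices lying over `Q`. -/
def sCoord (X : StratSSet P) (Q : Set P) (x : ((realization P).obj X).left) : ℝ :=
  (((sSetTopAdj.homEquiv X.left (TopCat.of (ULift.{u} ℝ))).symm
    (X.hom ≫ nerveMass P Q)).hom x).down

/-- The standard neighborhood system of `|X|`: the points with `s_{≰ p} ≤ s_p`. -/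
def standardNeighborhood (X : StratSSet P) (p : P) : Set ((realization P).obj X).left :=
  {x | sCoord X {q | ¬ q ≤ p} x ≤ sCoord X {p} x}

namespace StratTop

variable (T : StratTop P)

/-- The stratum of a point of a stratified space. -/
def stratum (x : T.left) : P := WithUpperSet.ofUpperSet (T.hom x)

variable {n : ℕ}

/-- Stratum-preserving maps from the realization of the stratified simplex of `J` to `T`. -/
def StratMap (J : Fin (n + 1) →o P) (T : StratTop P) : Type u :=
  {σ : C(stdSimplex ℝ (Fin (n + 1)), T.left) // ∀ x, stratum T (σ x) = simplexStratum J x}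

/-- The subspace topology of the compact-open topology. -/
instance (J : Fin (n + 1) →o P) : TopologicalSpace (StratMap J T) :=
  inferInstanceAs (TopologicalSpace
    {σ : C(stdSimplex ℝ (Fin (n + 1)), T.left) // ∀ x, stratum T (σ x) = simplexStratum J x})

variable (c : SpaceConvention)

/-- A subset of a stratified space, as a stratified space. -/
def restrict (A : Set T.left) : StratTop P :=
  Over.mk (Y := TopCat.of (c.Refine A)) (TopCat.ofHom
    ⟨fun x => T.hom (c.ofRefine x : A),
      T.hom.hom.continuous.comp (continuous_subtype_val.comp (c.continuous_ofRefine A))⟩)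

/-- The subspace of points of `T` whose stratum lies in `Q`. -/
abbrev Strata (Q : Set P) : Type u := c.Refine {x : T.left // stratum T x ∈ Q}

/-- The inclusion between such subspaces. -/
def strataInclusion {Q Q' : Set P} (h : Q ⊆ Q') : C(Strata T c Q, Strata T c Q') :=
  c.refineMap ⟨fun x => ⟨x.1, h x.2⟩, by fun_prop⟩

/-- The flag underlying a regular flag. -/
def flag (I : LTSeries P) : Fin (I.length + 1) →o P := ⟨I, I.monotone⟩

/-- The generalized homotopy link of `T` at the regular flag `I`. -/
abbrev HomotopyLink (I : LTSeries P) : Type u := c.Refine (StratMap (flag I) T)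

lemma stratum_apply_vertex_last (I : LTSeries P) (σ : StratMap (flag I) T) :
    stratum T (σ.1 (stdSimplex.vertex (Fin.last I.length))) ∈ ({I.last} : Set P) := by
  rw [σ.2, Set.mem_singleton_iff]
  refine (isGreatest_simplexStratum (flag I) _).unique ⟨⟨Fin.last _, by simp, rfl⟩, ?_⟩
  rintro _ ⟨i, -, rfl⟩
  exact (flag I).monotone (Fin.le_last i)

/-- Evaluation at the last vertex, from the homotopy link of `T` at `I = [p_0 < ⋯ < p_n]` to the
stratum of `T` at `p_n`. -/
def evLast (I : LTSeries P) : C(HomotopyLink T c I, Strata T c {I.last}) :=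
  c.refineMap
    ⟨fun σ => ⟨σ.1 (stdSimplex.vertex (Fin.last I.length)), stratum_apply_vertex_last T I σ⟩,
      ((ContinuousEvalConst.continuous_eval_const
        (stdSimplex.vertex (Fin.last I.length))).comp continuous_subtype_val).subtype_mk _⟩

/-- `U` is a `Δ_P`-neighborhood of `S`: its preimage under every stratum-preserving map from a
stratified simplex is a neighborhood of the preimage of `S`. -/
def IsDeltaNeighborhood (U S : Set T.left) : Prop :=
  ∀ (n : ℕ) (J : Fin (n + 1) →o P) (σ : StratMap J T), σ.1 ⁻¹' U ∈ 𝓝ˢ (σ.1 ⁻¹' S)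

/-- Strata-neighborhood systems of `T`. -/
def IsStrataNeighborhoodSystem (U : P → Set T.left) : Prop :=
  ∀ p, IsDeltaNeighborhood T (U p) {x | stratum T x = p} ∧ {x | stratum T x ≤ p} ⊆ U p

/-- The intersection of the neighborhoods of the strata in the regular flag `I`. -/
def flagNeighborhood {T : StratTop P} (U : P → Set T.left) (I : LTSeries P) : Set T.left :=
  ⋂ i, U (I i)

/-- The strata-neighborhood system `U` is a homotopy link model for `T`. -/
def IsHomotopyLinkModel (U : P → Set T.left) : Prop :=
  IsStrataNeighborhoodSystem T U ∧
    ∀ I : LTSeries P,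
      IsWeakEquivalence (evLast (restrict T c (flagNeighborhood U I)) c I) ∧
      IsWeakEquivalence (strataInclusion (restrict T c (flagNeighborhood U I)) c
        (Set.singleton_subset_iff.2 Set.self_mem_Ici : {I.last} ⊆ Set.Ici I.last))

end StratTop

end Stratified

end

end StratifiedLinks

namespace StratifiedLinks

noncomputable section

/-! ### Simplices of the geometric realization -/

section Realization

variable {K : SSet.{u}}

/-! The whole proof rests on one explicit homotopy. For `p : P`, the collapse `collapse X p` shrinks
the coordinates of vertices not below `p` and gives their mass to the vertices over `p`, the full
amount moved being `min s_{≰p} s_p`. It is compatible with the simplicial structure, so it lives on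
the whole realization. Before time 1 it preserves strata; at time 1 it sends every point of `U(p)`
not already below `p` into the stratum `p`; it fixes the part below `p`; and it preserves `U(q)`
whenever `q` is comparable to `p`, hence preserves `U(I)` for a flag containing `p`.

The collapse at the last element of the flag deforms `U(I)_{≥p_n}` onto `U(I)_{p_n}`, which gives
the second weak equivalence. For the first, apply the collapses at all `p_j` to a point of
`U(I)_{p_n}`, the one at `p_j` for time `x_0 + ... + x_j`. This time is 1 exactly when `j` is at
least the top vertex of `x`, so the result is a stratum-preserving simplex (`stratum_collapseList`):
a section of evaluation at the last vertex. A link `σ` is deformed to the section of its endpoint by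
first turning on the collapses and then sliding `x` to the last vertex inside `σ`.

The three conventions are treated at once: weak equivalences only see maps out of cubes, and passing
to a refined topology does not change which maps out of Euclidean spaces are continuous. Hence the
criterion `isWeakEquivalence_of_deltaContinuous` asks for continuity on Euclidean test spaces only.
-/

/-- The continuous map from the topological simplex given by a simplex of a simplicial set. -/
def simplexMap {n : SimplexCategoryᵒᵖ} (τ : K.obj n) :
    C(stdSimplex ℝ (Fin (n.unop.len + 1)), SSet.toTop.obj K) :=
  TopCat.toSSetObjEquiv _ n ((sSetTopAdj.unit.app K).app n τ)

/-- Maps out of the realization are all built through the adjunction; this is the rule that computes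
them on simplices. -/
lemma homEquiv_symm_simplexMap {Y : TopCat.{u}} (φ : K ⟶ TopCat.toSSet.obj Y)
    {n : SimplexCategoryᵒᵖ} (τ : K.obj n) (x : stdSimplex ℝ (Fin (n.unop.len + 1))) :
    ((sSetTopAdj.homEquiv K Y).symm φ).hom (simplexMap τ x) =
      TopCat.toSSetObjEquiv Y n (φ.app n τ) x := by
  obtain ⟨ψ, rfl⟩ := (sSetTopAdj.homEquiv K Y).surjective φ
  rw [Equiv.symm_apply_apply, Adjunction.homEquiv_unit]
  rfl

lemma simplexMap_map {m n : SimplexCategory} (f : m ⟶ n) (τ : K.obj (op n))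
    (x : stdSimplex ℝ (Fin (m.len + 1))) :
    simplexMap (K.map f.op τ) x = simplexMap τ (stdSimplex.map f.toOrderHom x) := by
  have h := ConcreteCategory.congr_hom ((sSetTopAdj.unit.app K).naturality f.op) τ
  have h' := congrArg (fun s => TopCat.toSSetObjEquiv _ _ s x) h
  exact h'

lemma realization_hom_ext {Y : TopCat.{u}} {f g : SSet.toTop.obj K ⟶ Y}
    (h : ∀ (n : SimplexCategoryᵒᵖ) (τ : K.obj n) (x : stdSimplex ℝ (Fin (n.unop.len + 1))),
      f.hom (simplexMap τ x) = g.hom (simplexMap τ x)) : f = g := by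
  apply (sSetTopAdj.homEquiv K Y).injective
  ext n τ
  apply (TopCat.toSSetObjEquiv Y n).injective
  ext x
  have hf := homEquiv_symm_simplexMap (sSetTopAdj.homEquiv K Y f) τ x
  have hg := homEquiv_symm_simplexMap (sSetTopAdj.homEquiv K Y g) τ x
  rw [Equiv.symm_apply_apply] at hf hg
  exact hf.symm.trans ((h n τ x).trans hg)

lemma exists_simplexMap (z : SSet.toTop.obj K) :
    ∃ (n : SimplexCategoryᵒᵖ) (τ : K.obj n) (x : stdSimplex ℝ (Fin (n.unop.len + 1))),
      simplexMap τ x = z := by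
  -- Every function into an indiscrete space is continuous, so the indicator of the union of the
  -- simplices can be compared with the constant `True` by extensionality on simplices.
  let Y : TopCat.{u} := @TopCat.of (ULift.{u} Prop) ⊤
  let F (χ : SSet.toTop.obj K → ULift.{u} Prop) : SSet.toTop.obj K ⟶ Y :=
    @TopCat.ofHom _ _ _ ⊤ (@ContinuousMap.mk _ _ _ ⊤ χ continuous_top)
  have h : F (fun z => ⟨∃ (n : SimplexCategoryᵒᵖ) (τ : K.obj n)
      (x : stdSimplex ℝ (Fin (n.unop.len + 1))), simplexMap τ x = z⟩) = F fun _ => ⟨True⟩ :=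
    realization_hom_ext fun n τ x => congrArg ULift.up (eq_true ⟨n, τ, x, rfl⟩)
  have h' := congrArg ULift.down (ConcreteCategory.congr_hom h z)
  exact of_eq_true h'

end Realization

/-! ### Collapsing a simplex onto the part below an element -/

section CollapseSimplex

open scoped unitInterval

variable {P : Type u} [PartialOrder P] {n : ℕ}

lemma simplexMass_apply (J : Fin (n + 1) →o P) (Q : Set P) [DecidablePred (· ∈ Q)]
    (x : stdSimplex ℝ (Fin (n + 1))) :
    simplexMass J Q x = ∑ i, if J i ∈ Q then x i else 0 := by
  change ∑ i : Fin (n + 1), _ = _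
  congr! 2

lemma simplexMass_nonneg (J : Fin (n + 1) →o P) (Q : Set P) (x : stdSimplex ℝ (Fin (n + 1))) :
    0 ≤ simplexMass J Q x := by
  classical
  rw [simplexMass_apply]
  exact Finset.sum_nonneg fun i _ => by
    split_ifs
    exacts [stdSimplex.zero_le x i, le_rfl]

lemma le_simplexMass (J : Fin (n + 1) →o P) {Q : Set P} (x : stdSimplex ℝ (Fin (n + 1)))
    {i : Fin (n + 1)} (hi : J i ∈ Q) : x i ≤ simplexMass J Q x := by
  classical
  rw [simplexMass_apply]
  refine le_of_eq_of_le (if_pos hi).symm (Finset.single_le_sum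
    (f := fun i => if J i ∈ Q then x i else 0) (fun i _ => ?_) (Finset.mem_univ i))
  split_ifs
  exacts [stdSimplex.zero_le x i, le_rfl]

lemma simplexMass_pos_iff (J : Fin (n + 1) →o P) (Q : Set P) (x : stdSimplex ℝ (Fin (n + 1))) :
    0 < simplexMass J Q x ↔ ∃ i, 0 < x i ∧ J i ∈ Q := by
  classical
  constructor
  · intro h
    rw [simplexMass_apply] at h
    obtain ⟨i, -, hi⟩ := Finset.exists_lt_of_sum_lt (s := Finset.univ)
      (f := fun _ : Fin (n + 1) => (0 : ℝ)) (by simpa using h)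
    split_ifs at hi with hQ
    · exact ⟨i, hi, hQ⟩
    · exact absurd hi (lt_irrefl _)
  · rintro ⟨i, hi, hQ⟩
    exact hi.trans_le (le_simplexMass J x hQ)

lemma simplexStratum_le_iff (J : Fin (n + 1) →o P) (x : stdSimplex ℝ (Fin (n + 1))) (p : P) :
    simplexStratum J x ≤ p ↔ simplexMass J {q | ¬ q ≤ p} x = 0 := by
  rw [← not_iff_not, ← ne_eq (simplexMass _ _ _), ← (simplexMass_nonneg _ _ _).lt_iff_ne',
    simplexMass_pos_iff]
  constructor
  · intro h
    obtain ⟨i, hi, hJ⟩ := (isGreatest_simplexStratum J x).1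
    exact ⟨i, hi, by rwa [Set.mem_ofPred_eq, hJ]⟩
  · rintro ⟨i, hi, hJ⟩ h
    exact hJ (((isGreatest_simplexStratum J x).2 ⟨i, hi, rfl⟩).trans h)

/-- The mass moved by the full collapse onto the part below `p`. -/
def movedMass (J : Fin (n + 1) →o P) (p : P) (x : stdSimplex ℝ (Fin (n + 1))) : ℝ :=
  min (simplexMass J {q | ¬ q ≤ p} x) (simplexMass J {p} x)

/-- The factor by which the collapse onto the part below `p` scales the coordinates of the vertices
over `q`. -/
def collapseFactor (J : Fin (n + 1) →o P) (p : P) (x : stdSimplex ℝ (Fin (n + 1))) (t : I)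
    (q : P) : ℝ :=
  open Classical in
  if q = p then 1 + t * (movedMass J p x / simplexMass J {p} x)
  else if q ≤ p then 1
  else 1 - t * (movedMass J p x / simplexMass J {q | ¬ q ≤ p} x)

lemma movedMass_nonneg (J : Fin (n + 1) →o P) (p : P) (x : stdSimplex ℝ (Fin (n + 1))) :
    0 ≤ movedMass J p x := le_min (simplexMass_nonneg _ _ _) (simplexMass_nonneg _ _ _)

/-- The convention `a / 0 = 0` does no harm: the moved mass is bounded by the denominator and
vanishes with it. -/
lemma movedMass_div_mul (J : Fin (n + 1) →o P) (p : P) (x : stdSimplex ℝ (Fin (n + 1))) :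
    movedMass J p x / simplexMass J {q | ¬ q ≤ p} x * simplexMass J {q | ¬ q ≤ p} x =
      movedMass J p x :=
  div_mul_cancel_of_imp fun h =>
    le_antisymm ((min_le_left _ _).trans h.le) (movedMass_nonneg J p x)

lemma movedMass_div_mul' (J : Fin (n + 1) →o P) (p : P) (x : stdSimplex ℝ (Fin (n + 1))) :
    movedMass J p x / simplexMass J {p} x * simplexMass J {p} x = movedMass J p x :=
  div_mul_cancel_of_imp fun h =>
    le_antisymm ((min_le_right _ _).trans h.le) (movedMass_nonneg J p x)

lemma mul_movedMass_div_le_one (J : Fin (n + 1) →o P) (p : P) (x : stdSimplex ℝ (Fin (n + 1)))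
    (t : I) : t * (movedMass J p x / simplexMass J {q | ¬ q ≤ p} x) ≤ t :=
  mul_le_of_le_one_right t.2.1 (div_le_one_of_le₀ (min_le_left _ _) (simplexMass_nonneg _ _ _))

lemma collapseFactor_nonneg (J : Fin (n + 1) →o P) (p : P) (x : stdSimplex ℝ (Fin (n + 1)))
    (t : I) (q : P) : 0 ≤ collapseFactor J p x t q := by
  unfold collapseFactor
  have h1 := mul_movedMass_div_le_one J p x t
  have h2 := t.2.2
  have h3 : 0 ≤ t * (movedMass J p x / simplexMass J {p} x) :=
    mul_nonneg t.2.1 (div_nonneg (movedMass_nonneg _ _ _) (simplexMass_nonneg _ _ _))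
  split_ifs <;> linarith

lemma collapseFactor_pos (J : Fin (n + 1) →o P) (p : P) (x : stdSimplex ℝ (Fin (n + 1)))
    (t : I) {q : P} (h : t ≠ 1 ∨ q ≤ p) : 0 < collapseFactor J p x t q := by
  unfold collapseFactor
  have h1 := mul_movedMass_div_le_one J p x t
  have h3 : 0 ≤ t * (movedMass J p x / simplexMass J {p} x) :=
    mul_nonneg t.2.1 (div_nonneg (movedMass_nonneg _ _ _) (simplexMass_nonneg _ _ _))
  split_ifs with h4 h5
  · linarith
  · exact one_pos
  · have : (t : ℝ) < 1 := unitInterval.lt_one_iff_ne_one.2 (h.resolve_right h5)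
    linarith

/-- The mass balance of the collapse. With `Q` everything it shows that the total stays 1; for other
`Q` it gives the new value of `s_Q`. -/
lemma sum_mul_collapseFactor (J : Fin (n + 1) →o P) (p : P) (x : stdSimplex ℝ (Fin (n + 1)))
    (t : I) (Q : Set P) [DecidablePred (· ∈ Q)] :
    ∑ i, (if J i ∈ Q then x i * collapseFactor J p x t (J i) else 0) =
      simplexMass J Q x + (if p ∈ Q then t * movedMass J p x else 0) -
        t * (movedMass J p x / simplexMass J {q | ¬ q ≤ p} x) *
          simplexMass J (Q ∩ {q | ¬ q ≤ p}) x := by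
  classical
  have h : ∀ i, (if J i ∈ Q then x i * collapseFactor J p x t (J i) else 0) =
      (if J i ∈ Q then x i else 0) + (if p ∈ Q then
        t * (movedMass J p x / simplexMass J {p} x) * (if J i ∈ ({p} : Set P) then x i else 0)
        else 0) -
      t * (movedMass J p x / simplexMass J {q | ¬ q ≤ p} x) *
        (if J i ∈ Q ∩ {q | ¬ q ≤ p} then x i else 0) := by
    intro i
    unfold collapseFactor
    by_cases h1 : J i = p
    · subst h1
      by_cases h2 : J i ∈ Q
      · simp [h2]; ring
      · simp [h2]
    · by_cases h2 : J i ∈ Q <;> by_cases h3 : J i ≤ p <;> simp [h1, h2, h3]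
      ring
  simp_rw [h]
  rw [Finset.sum_sub_distrib, Finset.sum_add_distrib, ← Finset.mul_sum, ← simplexMass_apply,
    ← simplexMass_apply]
  congr 2
  split_ifs
  · rw [← Finset.mul_sum, ← simplexMass_apply, mul_assoc, movedMass_div_mul']
  · simp

/-- The quotient lies in `[0, 1]` but may jump where `b` vanishes; there `f ≤ b` forces the product
to tend to 0. In the application `f` is a single coordinate contributing to the mass `b`. -/
lemma continuous_mul_min_div {Z : Type*} [TopologicalSpace Z] {f a b : Z → ℝ} (hf : Continuous f)
    (ha : Continuous a) (hb : Continuous b) (hf0 : ∀ z, 0 ≤ f z) (hfb : ∀ z, f z ≤ b z)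
    (ha0 : ∀ z, 0 ≤ a z) : Continuous fun z => f z * (min (a z) (b z) / b z) := by
  have hb0 : ∀ z, 0 ≤ b z := fun z => (hf0 z).trans (hfb z)
  rw [continuous_iff_continuousAt]
  intro z
  by_cases hz : b z = 0
  · have hfz : f z = 0 := le_antisymm ((hfb z).trans hz.le) (hf0 z)
    rw [ContinuousAt, hfz, zero_mul]
    refine squeeze_zero (fun z => mul_nonneg (hf0 z) (div_nonneg (le_min (ha0 z) (hb0 z)) (hb0 z)))
      (fun z => mul_le_of_le_one_right (hf0 z) (div_le_one_of_le₀ (min_le_right _ _) (hb0 z))) ?_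
    exact hfz ▸ hf.tendsto z
  · exact hf.continuousAt.mul ((ha.min hb).continuousAt.div hb.continuousAt hz)

/-- The collapse of a stratified simplex onto the part below `p`: the coordinates of vertices not
below `p` are shrunk, and their mass is moved to the vertices over `p`. -/
def simplexCollapse (J : Fin (n + 1) →o P) (p : P) :
    C(stdSimplex ℝ (Fin (n + 1)) × I, stdSimplex ℝ (Fin (n + 1))) where
  toFun z := ⟨fun i => z.1 i * collapseFactor J p z.1 z.2 (J i),
    fun i => mul_nonneg (stdSimplex.zero_le _ _) (collapseFactor_nonneg _ _ _ _ _), by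
      classical
      have h := sum_mul_collapseFactor J p z.1 z.2 Set.univ
      simp only [Set.mem_univ, if_true, Set.univ_inter] at h
      rw [h, mul_assoc, movedMass_div_mul, add_sub_cancel_right, simplexMass_apply]
      simp only [Set.mem_univ, if_true]
      exact stdSimplex.sum_eq_one _⟩
  continuous_toFun := by
    refine Continuous.subtype_mk (continuous_pi fun i => ?_) _
    have hx : Continuous fun z : stdSimplex ℝ (Fin (n + 1)) × I => z.1 i :=
      (continuous_apply i).comp (continuous_subtype_val.comp continuous_fst)
    have hm : ∀ Q : Set P, Continuous fun z : stdSimplex ℝ (Fin (n + 1)) × I =>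
      simplexMass J Q z.1 := fun Q => (simplexMass J Q).continuous.comp continuous_fst
    have ht : Continuous fun z : stdSimplex ℝ (Fin (n + 1)) × I => (z.2 : ℝ) :=
      continuous_subtype_val.comp continuous_snd
    unfold collapseFactor
    split_ifs with h1 h2
    · have h := continuous_mul_min_div hx (hm {q | ¬ q ≤ p}) (hm {p})
        (fun z => stdSimplex.zero_le _ _) (fun z => le_simplexMass J z.1 h1)
        (fun z => simplexMass_nonneg _ _ _)
      refine (hx.add (ht.mul h)).congr fun z => ?_
      simp only [movedMass, Pi.add_apply, Pi.mul_apply]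
      ring
    · simpa using hx
    · have h := continuous_mul_min_div hx (hm {p}) (hm {q | ¬ q ≤ p})
        (fun z => stdSimplex.zero_le _ _) (fun z => le_simplexMass J z.1 h2)
        (fun z => simplexMass_nonneg _ _ _)
      refine (hx.sub (ht.mul h)).congr fun z => ?_
      simp only [movedMass, min_comm, Pi.sub_apply, Pi.mul_apply]
      ring

lemma simplexCollapse_apply (J : Fin (n + 1) →o P) (p : P) (x : stdSimplex ℝ (Fin (n + 1)))
    (t : I) (i : Fin (n + 1)) :
    simplexCollapse J p (x, t) i = x i * collapseFactor J p x t (J i) := rfl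

/-- The scaling factor of a coordinate depends only on its element of `P` and on masses, both
compatible with simplicial operators. This naturality is what makes the collapses glue. -/
lemma map_simplexCollapse {m : ℕ} (J : Fin (n + 1) →o P) (p : P)
    (f : Fin (m + 1) →o Fin (n + 1)) (x : stdSimplex ℝ (Fin (m + 1))) (t : I) :
    stdSimplex.map f (simplexCollapse (J.comp f) p (x, t)) =
      simplexCollapse J p (stdSimplex.map f x, t) := by
  classical
  ext i
  have h : collapseFactor (J.comp f) p x t = collapseFactor J p (stdSimplex.map f x) t := by
    ext q
    simp only [collapseFactor, movedMass, simplexMass_map]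
  rw [simplexCollapse_apply, stdSimplex.map_coe, stdSimplex.map_coe,
    FunOnFinite.linearMap_apply_apply, FunOnFinite.linearMap_apply_apply, Finset.sum_mul]
  refine Finset.sum_congr rfl fun j hj => ?_
  rw [simplexCollapse_apply, h, ← (Finset.mem_filter.1 hj).2]
  rfl

lemma simplexMass_simplexCollapse (J : Fin (n + 1) →o P) (p : P)
    (x : stdSimplex ℝ (Fin (n + 1))) (t : I) (Q : Set P) [DecidablePred (· ∈ Q)] :
    simplexMass J Q (simplexCollapse J p (x, t)) =
      simplexMass J Q x + (if p ∈ Q then t * movedMass J p x else 0) -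
        t * (movedMass J p x / simplexMass J {q | ¬ q ≤ p} x) *
          simplexMass J (Q ∩ {q | ¬ q ≤ p}) x := by
  rw [simplexMass_apply, ← sum_mul_collapseFactor]
  rfl

lemma simplexCollapse_eq_self (J : Fin (n + 1) →o P) (p : P) (x : stdSimplex ℝ (Fin (n + 1)))
    (t : I) (h : t = 0 ∨ simplexStratum J x ≤ p) : simplexCollapse J p (x, t) = x := by
  have h0 : t * movedMass J p x = 0 := by
    rcases h with h | h
    · simp [h]
    · have h' : movedMass J p x = 0 := le_antisymm
        ((min_le_left _ _).trans ((simplexStratum_le_iff J x p).1 h).le) (movedMass_nonneg J p x)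
      rw [h', mul_zero]
  ext i
  rw [simplexCollapse_apply, collapseFactor]
  split_ifs <;> simp [← mul_div_assoc, h0]

lemma simplexStratum_simplexCollapse_of_ne_one (J : Fin (n + 1) →o P) (p : P)
    (x : stdSimplex ℝ (Fin (n + 1))) {t : I} (ht : t ≠ 1) :
    simplexStratum J (simplexCollapse J p (x, t)) = simplexStratum J x := by
  refine (isGreatest_simplexStratum J _).unique ?_
  convert isGreatest_simplexStratum J x using 1
  ext q
  refine exists_congr fun i => and_congr_left' ?_
  rw [simplexCollapse_apply, mul_pos_iff_of_pos_right (collapseFactor_pos J p x t (Or.inl ht))]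

/-- Under the inequality defining `U(p)` the moved mass is all the mass not below `p`, so those
coordinates become 0. The inequality also forces `s_p > 0`, so some vertex over `p` survives. -/
lemma simplexStratum_simplexCollapse_one (J : Fin (n + 1) →o P) (p : P)
    (x : stdSimplex ℝ (Fin (n + 1)))
    (hx : simplexMass J {q | ¬ q ≤ p} x ≤ simplexMass J {p} x) (hp : ¬ simplexStratum J x ≤ p) :
    simplexStratum J (simplexCollapse J p (x, 1)) = p := by
  rw [simplexStratum_le_iff] at hp
  have ha := (simplexMass_nonneg J {q | ¬ q ≤ p} x).lt_of_ne' hp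
  refine (isGreatest_simplexStratum J _).unique ⟨?_, ?_⟩
  · obtain ⟨i, hi, hJ⟩ := (simplexMass_pos_iff J {p} x).1 (ha.trans_le hx)
    exact ⟨i, mul_pos hi (collapseFactor_pos J p x 1 (Or.inr (le_of_eq hJ))), hJ⟩
  · rintro _ ⟨i, hi, rfl⟩
    by_contra h
    rw [simplexCollapse_apply, collapseFactor, if_neg fun h' => h h'.le, if_neg h, movedMass,
      min_eq_left hx, div_self hp] at hi
    simp at hi

/-- If `q = p`, the left side decreases and the right side increases. If `p < q`, both sides are
scaled by the same nonnegative factor. If `q < p`, mass only moves among vertices not below `q`, so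
neither side changes. -/
lemma simplexMass_le_simplexCollapse (J : Fin (n + 1) →o P) (p : P)
    (x : stdSimplex ℝ (Fin (n + 1))) (t : I) {q : P} (hq : q ≤ p ∨ p ≤ q)
    (hx : simplexMass J {r | ¬ r ≤ q} x ≤ simplexMass J {q} x) :
    simplexMass J {r | ¬ r ≤ q} (simplexCollapse J p (x, t)) ≤
      simplexMass J {q} (simplexCollapse J p (x, t)) := by
  classical
  rw [simplexMass_simplexCollapse, simplexMass_simplexCollapse]
  have hm := mul_nonneg t.2.1 (movedMass_nonneg J p x)
  have h0 : simplexMass J ∅ x = 0 := by simp [simplexMass_apply]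
  by_cases hpq : p ≤ q
  · have h1 : {r | ¬ r ≤ q} ∩ {r | ¬ r ≤ p} = {r | ¬ r ≤ q} :=
      Set.inter_eq_left.2 fun r hr h => hr (h.trans hpq)
    rw [h1, if_neg (by simpa using hpq)]
    by_cases hqp : q ≤ p
    · obtain rfl := le_antisymm hpq hqp
      have h2 : ({p} ∩ {r | ¬ r ≤ p} : Set P) = ∅ := by ext r; simp +contextual
      rw [h2, if_pos (Set.mem_singleton p), mul_assoc, movedMass_div_mul, h0]
      linarith
    · have h2 : ({q} ∩ {r | ¬ r ≤ p} : Set P) = {q} := by simpa using hqp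
      rw [h2, if_neg fun h => hqp (le_of_eq (Set.mem_singleton_iff.1 h).symm)]
      have h3 := (mul_movedMass_div_le_one J p x t).trans t.2.2
      nlinarith
  · have hqp := hq.resolve_right hpq
    have h1 : {r | ¬ r ≤ q} ∩ {r | ¬ r ≤ p} = {r | ¬ r ≤ p} :=
      Set.inter_eq_right.2 fun r hr h => hr (h.trans hqp)
    have h2 : ({q} ∩ {r | ¬ r ≤ p} : Set P) = ∅ := by
      rw [Set.singleton_inter_eq_empty]
      simpa using hqp
    rw [h1, h2, if_pos (show p ∈ {r | ¬ r ≤ q} from hpq),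
      if_neg fun h => hpq (le_of_eq (Set.mem_singleton_iff.1 h)), mul_assoc, movedMass_div_mul, h0]
    linarith

end CollapseSimplex

/-! ### The collapse on the realization of a stratified simplicial set -/

section Collapse

open scoped unitInterval
open StratTop

variable {P : Type u} [PartialOrder P] (X : StratSSet P)

variable {X} in
/-- The flag of `P` under a simplex of a stratified simplicial set. -/
def simplexFlag {n : SimplexCategoryᵒᵖ} (τ : X.left.obj n) : Fin (n.unop.len + 1) →o P :=
  nerveFlag (X.hom.app n τ)

lemma simplexFlag_map {m n : SimplexCategory} (f : m ⟶ n) (τ : X.left.obj (op n)) :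
    simplexFlag (X := X) (X.left.map f.op τ) = (simplexFlag τ).comp f.toOrderHom := by
  have h := ConcreteCategory.congr_hom (X.hom.naturality f.op) τ
  exact congrArg nerveFlag h

variable {X} in
/-- The continuous map from the topological simplex given by a simplex of a stratified simplicial
set. -/
def realizationSimplex {n : SimplexCategoryᵒᵖ} (τ : X.left.obj n) :
    C(stdSimplex ℝ (Fin (n.unop.len + 1)), ((realization P).obj X).left) := simplexMap τ

lemma stratum_realizationSimplex {n : SimplexCategoryᵒᵖ} (τ : X.left.obj n)
    (x : stdSimplex ℝ (Fin (n.unop.len + 1))) :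
    stratum ((realization P).obj X) (realizationSimplex τ x) = simplexStratum (simplexFlag τ) x := by
  have h : ((realization P).obj X).hom =
      (sSetTopAdj.homEquiv X.left (TopCat.of (WithUpperSet P))).symm (X.hom ≫ nerveToSing P) :=
    (sSetTopAdj.homEquiv_naturality_left_symm _ _).symm
  change WithUpperSet.ofUpperSet (((realization P).obj X).hom (realizationSimplex τ x)) = _
  rw [h]
  exact congrArg WithUpperSet.ofUpperSet (homEquiv_symm_simplexMap _ τ x)

lemma sCoord_realizationSimplex (Q : Set P) {n : SimplexCategoryᵒᵖ} (τ : X.left.obj n)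
    (x : stdSimplex ℝ (Fin (n.unop.len + 1))) :
    sCoord X Q (realizationSimplex τ x) = simplexMass (simplexFlag τ) Q x :=
  congrArg ULift.down (homEquiv_symm_simplexMap (X.hom ≫ nerveMass P Q) τ x)

lemma continuous_sCoord (Q : Set P) : Continuous (sCoord X Q) :=
  continuous_uliftDown.comp (TopCat.Hom.hom _).continuous

/-- The collapse, as a map from a stratified simplicial set to the singular simplicial set of the
space of paths in its realization. -/
def collapseSimplicial (p : P) :
    X.left ⟶ TopCat.toSSet.obj (TopCat.of C(I, SSet.toTop.obj X.left)) where
  app n := TypeCat.ofHom fun τ =>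
    (TopCat.toSSetObjEquiv (TopCat.of C(I, SSet.toTop.obj X.left)) n).symm
      ((simplexMap τ).comp (simplexCollapse (simplexFlag τ) p)).curry
  naturality := by
    intro n m f
    ext τ
    apply (TopCat.toSSetObjEquiv (TopCat.of C(I, SSet.toTop.obj X.left)) m).injective
    ext x t
    change simplexMap (X.left.map f τ) (simplexCollapse (simplexFlag (X.left.map f τ)) p (x, t)) =
      simplexMap τ (simplexCollapse (simplexFlag τ) p (stdSimplex.map f.unop.toOrderHom x, t))
    rw [← map_simplexCollapse, ← simplexMap_map, ← simplexFlag_map]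
    rfl

/-- The collapse of the realization of a stratified simplicial set onto the part below `p`, given
on simplices by `simplexCollapse`. -/
def collapse (p : P) : C(((realization P).obj X).left × I, ((realization P).obj X).left) :=
  -- Mapping into the path space and uncurrying (the interval is locally compact) gives joint
  -- continuity without describing `|X| × I` as a realization.
  ContinuousMap.uncurry ((sSetTopAdj.homEquiv X.left
    (TopCat.of C(I, SSet.toTop.obj X.left))).symm (collapseSimplicial X p)).hom

lemma collapse_realizationSimplex (p : P) {n : SimplexCategoryᵒᵖ} (τ : X.left.obj n)
    (x : stdSimplex ℝ (Fin (n.unop.len + 1))) (t : I) :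
    collapse X p (realizationSimplex τ x, t) =
      realizationSimplex τ (simplexCollapse (simplexFlag τ) p (x, t)) :=
  congrArg (fun g : C(I, SSet.toTop.obj X.left) => g t)
    (homEquiv_symm_simplexMap (collapseSimplicial X p) τ x)

variable {X}

lemma exists_realizationSimplex_eq (z : ((realization P).obj X).left) :
    ∃ (n : SimplexCategoryᵒᵖ) (τ : X.left.obj n) (x : stdSimplex ℝ (Fin (n.unop.len + 1))),
      realizationSimplex τ x = z := exists_simplexMap z

lemma collapse_eq_self {p : P} {z : ((realization P).obj X).left} {t : I}
    (h : t = 0 ∨ stratum _ z ≤ p) : collapse X p (z, t) = z := by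
  obtain ⟨n, τ, x, rfl⟩ := exists_realizationSimplex_eq z
  rw [stratum_realizationSimplex] at h
  rw [collapse_realizationSimplex, simplexCollapse_eq_self _ _ _ _ h]

lemma stratum_collapse_of_ne_one (p : P) (z : ((realization P).obj X).left) {t : I}
    (ht : t ≠ 1) : stratum _ (collapse X p (z, t)) = stratum _ z := by
  obtain ⟨n, τ, x, rfl⟩ := exists_realizationSimplex_eq z
  rw [collapse_realizationSimplex, stratum_realizationSimplex, stratum_realizationSimplex,
    simplexStratum_simplexCollapse_of_ne_one _ _ _ ht]

lemma mem_standardNeighborhood_iff {p : P} {z : ((realization P).obj X).left} :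
    z ∈ standardNeighborhood X p ↔ sCoord X {q | ¬ q ≤ p} z ≤ sCoord X {p} z := Iff.rfl

lemma stratum_collapse_one {p : P} {z : ((realization P).obj X).left}
    (hz : z ∈ standardNeighborhood X p) (hp : ¬ stratum _ z ≤ p) :
    stratum _ (collapse X p (z, 1)) = p := by
  obtain ⟨n, τ, x, rfl⟩ := exists_realizationSimplex_eq z
  rw [mem_standardNeighborhood_iff, sCoord_realizationSimplex, sCoord_realizationSimplex] at hz
  rw [stratum_realizationSimplex] at hp
  rw [collapse_realizationSimplex, stratum_realizationSimplex,
    simplexStratum_simplexCollapse_one _ _ _ hz hp]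

lemma collapse_mem_standardNeighborhood (p : P) {q : P} (hq : q ≤ p ∨ p ≤ q)
    {z : ((realization P).obj X).left} (hz : z ∈ standardNeighborhood X q) (t : I) :
    collapse X p (z, t) ∈ standardNeighborhood X q := by
  obtain ⟨n, τ, x, rfl⟩ := exists_realizationSimplex_eq z
  rw [mem_standardNeighborhood_iff, sCoord_realizationSimplex, sCoord_realizationSimplex] at hz
  rw [collapse_realizationSimplex, mem_standardNeighborhood_iff, sCoord_realizationSimplex,
    sCoord_realizationSimplex]
  exact simplexMass_le_simplexCollapse _ _ _ _ hq hz

/-! ### The standard neighborhoods -/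

lemma sCoord_nonneg (Q : Set P) (z : ((realization P).obj X).left) : 0 ≤ sCoord X Q z := by
  obtain ⟨n, τ, x, rfl⟩ := exists_realizationSimplex_eq z
  rw [sCoord_realizationSimplex]
  exact simplexMass_nonneg _ _ _

lemma stratum_le_iff (p : P) (z : ((realization P).obj X).left) :
    stratum _ z ≤ p ↔ sCoord X {q | ¬ q ≤ p} z = 0 := by
  obtain ⟨n, τ, x, rfl⟩ := exists_realizationSimplex_eq z
  rw [sCoord_realizationSimplex, stratum_realizationSimplex, simplexStratum_le_iff]

lemma sCoord_stratum_pos (z : ((realization P).obj X).left) : 0 < sCoord X {stratum _ z} z := by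
  obtain ⟨n, τ, x, rfl⟩ := exists_realizationSimplex_eq z
  rw [sCoord_realizationSimplex, stratum_realizationSimplex, simplexMass_pos_iff]
  exact (isGreatest_simplexStratum _ _).1

variable (X) in
-- On the stratum `p` one has `s_{≰p} = 0 < s_p`, and the strict inequality defines an open subset
-- of `U(p)`.
theorem isStrataNeighborhoodSystem_standardNeighborhood :
    IsStrataNeighborhoodSystem ((realization P).obj X) (standardNeighborhood X) := by
  refine fun p => ⟨fun n J f => ?_, fun z hz => ?_⟩
  · have ho : IsOpen {z | sCoord X {q | ¬ q ≤ p} z < sCoord X {p} z} :=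
      isOpen_lt (continuous_sCoord X _) (continuous_sCoord X _)
    refine Filter.mem_of_superset ((ho.preimage f.1.continuous).mem_nhdsSet.2 ?_)
      (Set.preimage_mono fun z hz => le_of_lt (Set.mem_ofPred_eq ▸ hz))
    refine Set.preimage_mono fun z hz => ?_
    obtain rfl : stratum _ z = p := hz
    rw [Set.mem_ofPred_eq, (stratum_le_iff _ _).1 le_rfl]
    exact sCoord_stratum_pos z
  · rw [mem_standardNeighborhood_iff, (stratum_le_iff p z).1 hz]
    exact sCoord_nonneg _ _

end Collapse

/-! ### Maps that are continuous on Euclidean test spaces -/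

section DeltaContinuous

open scoped unitInterval

/-- Maps that become continuous after composition with continuous maps from Euclidean spaces. -/
def DeltaContinuous {X Y : Type*} [TopologicalSpace X] [TopologicalSpace Y] (f : X → Y) : Prop :=
  ∀ (n : ℕ) (g : C(Fin n → ℝ, X)), Continuous (f ∘ g)

/-- Retracts of finite-dimensional Euclidean spaces. -/
class IsEuclideanRetract (K : Type*) [TopologicalSpace K] : Prop where
  exists_retraction : ∃ (ι : Type) (_ : Finite ι) (i : C(K, ι → ℝ)) (r : C(ι → ℝ, K)),
    ∀ k, r (i k) = k

instance (n : ℕ) : IsEuclideanRetract (Fin n → ℝ) :=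
  ⟨Fin n, inferInstance, .id _, .id _, fun _ => rfl⟩

instance : IsEuclideanRetract I :=
  ⟨Unit, inferInstance, ⟨fun t _ => t, by fun_prop⟩,
    ⟨fun z => Set.projIcc 0 1 zero_le_one (z ()), by fun_prop⟩,
    fun t => Set.projIcc_val zero_le_one t⟩

instance {ι : Type} [Finite ι] {K : Type*} [TopologicalSpace K] [IsEuclideanRetract K] :
    IsEuclideanRetract (ι → K) := by
  obtain ⟨κ, _, i, r, h⟩ := IsEuclideanRetract.exists_retraction (K := K)
  exact ⟨ι × κ, inferInstance, ⟨fun k a => i (k a.1) a.2, by fun_prop⟩,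
    ⟨fun z a => r fun b => z (a, b), by fun_prop⟩, fun k => funext fun a => h (k a)⟩

instance {K L : Type*} [TopologicalSpace K] [TopologicalSpace L] [IsEuclideanRetract K]
    [IsEuclideanRetract L] : IsEuclideanRetract (K × L) := by
  obtain ⟨κ, _, i, r, h⟩ := IsEuclideanRetract.exists_retraction (K := K)
  obtain ⟨κ', _, i', r', h'⟩ := IsEuclideanRetract.exists_retraction (K := L)
  refine ⟨κ ⊕ κ', inferInstance, ⟨fun k => Sum.elim (i k.1) (i' k.2), ?_⟩,
    ⟨fun z => (r fun a => z (.inl a), r' fun a => z (.inr a)), by fun_prop⟩,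
    fun k => Prod.ext (h k.1) (h' k.2)⟩
  exact continuous_pi fun a => by cases a <;> simp only [Sum.elim_inl, Sum.elim_inr] <;> fun_prop

instance (n : ℕ) : IsEuclideanRetract (stdSimplex ℝ (Fin (n + 1))) := by
  let W (z : Fin (n + 1) → ℝ) : ℝ := ∑ i, max (z i) 0
  have hW : ∀ z, 0 ≤ W z := fun z => Finset.sum_nonneg fun i _ => le_max_right _ _
  have hm : ∀ z, 0 < max (W z) 1 := fun z => one_pos.trans_le (le_max_right _ _)
  have hcW : Continuous W := by fun_prop
  have hn : (0 : ℝ) < n + 1 := by positivity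
  refine ⟨Fin (n + 1), inferInstance, ⟨Subtype.val, continuous_subtype_val⟩,
    -- Discard negative parts; if the remaining total `W z` is below 1, spread the deficit evenly,
    -- and if it exceeds 1, rescale.
    ⟨fun z => ⟨fun i => (max (z i) 0 + max (1 - W z) 0 / (n + 1)) / max (W z) 1,
      fun i => div_nonneg (add_nonneg (le_max_right _ _)
        (div_nonneg (le_max_right _ _) hn.le)) (hm z).le, ?_⟩, ?_⟩, fun x => ?_⟩
  · rw [← Finset.sum_div, Finset.sum_add_distrib, Finset.sum_const, Finset.card_univ,
      Fintype.card_fin, nsmul_eq_mul, Nat.cast_add, Nat.cast_one, mul_div_cancel₀ _ hn.ne',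
      div_eq_one_iff_eq (hm z).ne']
    change W z + _ = _
    rcases le_total (W z) 1 with h | h
    · rw [max_eq_left (sub_nonneg.2 h), max_eq_right h, add_sub_cancel]
    · rw [max_eq_right (sub_nonpos.2 h), max_eq_left h, add_zero]
  · refine Continuous.subtype_mk (continuous_pi fun i => Continuous.div ?_ ?_ fun z => (hm z).ne') _
    · fun_prop
    · fun_prop
  · have h1 : ∀ i, max (x.1 i) 0 = x.1 i := fun i => max_eq_left (x.2.1 i)
    have h2 : W x.1 = 1 := by
      simp only [W, h1]
      exact x.2.2
    ext i
    change (max (x.1 i) 0 + max (1 - W x.1) 0 / (n + 1)) / max (W x.1) 1 = x.1 i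
    simp [h1, h2]

variable {X Y Z K : Type*} [TopologicalSpace X] [TopologicalSpace Y] [TopologicalSpace Z]
  [TopologicalSpace K]

lemma _root_.Continuous.deltaContinuous {f : X → Y} (hf : Continuous f) : DeltaContinuous f :=
  fun _ g => hf.comp g.continuous

namespace DeltaContinuous

/-- A map out of `K` extends along the retraction to a Euclidean space, where the hypothesis
applies. This covers cubes, simplices and their products. -/
lemma comp_continuous [IsEuclideanRetract K] {f : X → Y} (hf : DeltaContinuous f) {k : K → X}
    (hk : Continuous k) : Continuous (fun a => f (k a)) := by
  obtain ⟨ι, _, i, r, h⟩ := IsEuclideanRetract.exists_retraction (K := K)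
  obtain ⟨n, ⟨e⟩⟩ := Finite.exists_equiv_fin ι
  have h1 := hf n ⟨fun z => k (r fun a => z (e a)), by fun_prop⟩
  refine (h1.comp (g := _) (f := fun a (b : Fin n) => i a (e.symm b)) (by fun_prop)).congr
    fun a => ?_
  simp [h]

lemma comp {g : Y → Z} {f : X → Y} (hg : DeltaContinuous g) (hf : DeltaContinuous f) :
    DeltaContinuous fun x => g (f x) :=
  fun n k => hg n ⟨f ∘ k, hf n k⟩

lemma prodMk {f : X → Y} {g : X → Z} (hf : DeltaContinuous f) (hg : DeltaContinuous g) :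
    DeltaContinuous fun x => (f x, g x) :=
  fun n k => (hf n k).prodMk (hg n k)

lemma subtype_mk {p : Y → Prop} {f : X → Y} (hf : DeltaContinuous f) (h : ∀ x, p (f x)) :
    DeltaContinuous fun x => (⟨f x, h x⟩ : Subtype p) :=
  fun n k => (hf n k).subtype_mk _

lemma curry [IsEuclideanRetract K] {F : X × K → Y} (hF : DeltaContinuous F)
    {f : X → C(K, Y)} (hf : ∀ x k, f x k = F (x, k)) : DeltaContinuous f := by
  intro n g
  have h : Continuous fun z : (Fin n → ℝ) × K => F (g z.1, z.2) :=
    hF.comp_continuous (by fun_prop)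
  exact (ContinuousMap.curry ⟨_, h⟩).continuous.congr fun z => by ext k; exact (hf _ _).symm

end DeltaContinuous

end DeltaContinuous

lemma SpaceConvention.deltaContinuous_toRefine (c : SpaceConvention) (X : Type u)
    [TopologicalSpace X] : DeltaContinuous (c.toRefine (X := X)) := by
  intro n g
  cases c with
  | general => exact g.continuous
  | compactlyGenerated =>
    -- Euclidean spaces are compactly generated, so it suffices to test on compact Hausdorff spaces
    -- mapping to them.
    refine _root_.continuous_from_uCompactlyGeneratedSpace.{u}
      (Y := SpaceConvention.compactlyGenerated.Refine X) g fun S k => ?_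
    let F : (Σ (i : (S : CompHaus.{u}) × C(S, X)), i.fst) →
      SpaceConvention.compactlyGenerated.Refine X := fun a => a.1.2 a.2
    have hF : Continuous F := continuous_coinduced_rng
    exact hF.comp (continuous_sigmaMk (σ := fun i : (S : CompHaus.{u}) × C(S, X) => i.fst)
      (i := ⟨S, g.comp k⟩))
  | deltaGenerated =>
    exact continuous_iff_coinduced_le.2 (le_iSup₂_of_le (f := fun (i : ℕ) (h : C(Fin i → ℝ, X)) =>
      TopologicalSpace.coinduced h inferInstance) n g le_rfl)

/-! ### A criterion for weak equivalences -/

section Collar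

open scoped unitInterval

variable {n : ℕ} {X : Type*}

/-- The distance to the center of the unit cube. -/
def centerDist (z : Fin n → I) : ℝ := dist z fun _ => ⟨1 / 2, by norm_num, by norm_num⟩

/-- For `t = 1`, the radial expansion of the middle half of the unit cube onto the cube; for
`t = 0`, the identity. -/
def cubeExpand (t : I) (z : Fin n → I) : Fin n → I :=
  fun i => Set.projIcc 0 1 zero_le_one ((1 + t) * z i - t / 2)

lemma continuous_centerDist : Continuous (centerDist (n := n)) :=
  continuous_id.dist continuous_const

lemma continuous_cubeExpand : Continuous fun w : I × (Fin n → I) => cubeExpand w.1 w.2 := by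
  unfold cubeExpand
  fun_prop

lemma cubeExpand_zero (z : Fin n → I) : cubeExpand 0 z = z := by
  ext i
  simp [cubeExpand]

lemma cubeExpand_mem_boundary (t : I) {z : Fin n → I} (hz : z ∈ Cube.boundary (Fin n)) :
    cubeExpand t z ∈ Cube.boundary (Fin n) := by
  obtain ⟨i, hi | hi⟩ := hz
  · refine ⟨i, Or.inl ((Set.projIcc_eq_left zero_lt_one).2 ?_)⟩
    rw [hi, Set.Icc.coe_zero]
    linarith [t.2.1]
  · refine ⟨i, Or.inr ((Set.projIcc_eq_right zero_lt_one).2 ?_)⟩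
    rw [hi, Set.Icc.coe_one]
    linarith [t.2.1]

/-- The distance is the sup distance, so the middle half is the ball of radius 1/4; on it and
beyond, clamping pushes some coordinate to 0 or 1. -/
lemma cubeExpand_one_mem_boundary {z : Fin n → I} (hz : 1 / 4 ≤ centerDist z) :
    cubeExpand 1 z ∈ Cube.boundary (Fin n) := by
  by_contra h
  refine hz.not_gt ((dist_pi_lt_iff (by norm_num)).2 fun i => ?_)
  have h0 : ¬ (cubeExpand 1 z i = 0 ∨ cubeExpand 1 z i = 1) := fun h' => h ⟨i, h'⟩
  rw [not_or] at h0
  have h1 := not_le.1 fun h' => h0.1 ((Set.projIcc_eq_left zero_lt_one).2 h')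
  have h2 := not_le.1 fun h' => h0.2 ((Set.projIcc_eq_right zero_lt_one).2 h')
  rw [Set.Icc.coe_one] at h1 h2
  rw [Subtype.dist_eq, Real.dist_eq, abs_lt]
  constructor <;> dsimp only <;> linarith

lemma half_le_centerDist {z : Fin n → I} (hz : z ∈ Cube.boundary (Fin n)) :
    1 / 2 ≤ centerDist z := by
  obtain ⟨i, hi⟩ := hz
  refine le_trans ?_ (dist_le_pi_dist _ _ i)
  rw [Subtype.dist_eq, Real.dist_eq]
  rcases hi with hi | hi <;> rw [hi] <;> norm_num [abs_of_nonneg, abs_of_neg]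

/-- The map on the cube given by `δ` on the expanded middle half, and by `l` radially on the
complementary collar. -/
def collar (l : I → X) (δ : (Fin n → I) → X) (z : Fin n → I) : X :=
  if centerDist z ≤ 1 / 4 then δ (cubeExpand 1 z)
  else l (Set.projIcc 0 1 zero_le_one (2 - 4 * centerDist z))

lemma continuous_collar {Z : Type*} [TopologicalSpace X] [TopologicalSpace Z] {l : Z × I → X}
    {δ : Z × (Fin n → I) → X} (hl : Continuous l) (hδ : Continuous δ)
    (h : ∀ w, ∀ z ∈ Cube.boundary (Fin n), δ (w, z) = l (w, 1)) :
    Continuous fun w : Z × (Fin n → I) =>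
      collar (fun v => l (w.1, v)) (fun z => δ (w.1, z)) w.2 := by
  have hc : Continuous fun w : Z × (Fin n → I) => centerDist w.2 :=
    continuous_centerDist.comp continuous_snd
  have he : Continuous fun w : Z × (Fin n → I) => cubeExpand 1 w.2 :=
    continuous_cubeExpand.comp (continuous_const.prodMk continuous_snd)
  refine Continuous.if_le (by fun_prop) (by fun_prop) hc continuous_const fun w hw => ?_
  -- The two branches agree at distance 1/4: the radial parameter `2 - 4 * centerDist` equals 1
  -- there, and 0 at distance 1/2, on the boundary of the cube.
  refine (h _ _ (cubeExpand_one_mem_boundary hw.ge)).trans ?_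
  rw [hw]
  congr
  exact ((Set.projIcc_eq_right zero_lt_one).2 (by norm_num)).symm

lemma collar_of_mem_boundary (l : I → X) (δ : (Fin n → I) → X) {z : Fin n → I}
    (hz : z ∈ Cube.boundary (Fin n)) : collar l δ z = l 0 := by
  have h := half_le_centerDist hz
  rw [collar, if_neg (by linarith)]
  congr
  exact (Set.projIcc_eq_left zero_lt_one).2 (by linarith)

lemma collar_const {x : X} {δ : (Fin n → I) → X} (h : ∀ z ∈ Cube.boundary (Fin n), δ z = x)
    (z : Fin n → I) : collar (fun _ => x) δ z = δ (cubeExpand 1 z) := by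
  unfold collar
  split_ifs with hz
  · rfl
  · exact (h _ (cubeExpand_one_mem_boundary (not_le.1 hz).le)).symm

variable [TopologicalSpace X]

lemma homotopic_cubeExpand {x : X} {γ γ' : GenLoop (Fin n) X x}
    (h : ∀ z, γ' z = γ (cubeExpand 1 z)) : GenLoop.Homotopic γ γ' :=
  ⟨{ toFun := fun w => γ (cubeExpand w.1 w.2)
     continuous_toFun := γ.1.continuous.comp continuous_cubeExpand
     map_zero_left := fun z => congrArg γ (cubeExpand_zero z)
     map_one_left := fun z => (h z).symm
     prop' := fun t z hz => (γ.2 _ (cubeExpand_mem_boundary t hz)).trans (γ.2 z hz).symm }⟩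

lemma homotopic_of_eq_collar {x : X} {γ₀ γ₁ : GenLoop (Fin n) X x} {l : I × I → X}
    {δ : I × (Fin n → I) → X} (hl : Continuous l) (hδ : Continuous δ)
    (h : ∀ t, ∀ z ∈ Cube.boundary (Fin n), δ (t, z) = l (t, 1)) (hx : ∀ t, l (t, 0) = x)
    (h₀ : ∀ z, γ₀ z = collar (fun v => l (0, v)) (fun z => δ (0, z)) z)
    (h₁ : ∀ z, γ₁ z = collar (fun v => l (1, v)) (fun z => δ (1, z)) z) :
    GenLoop.Homotopic γ₀ γ₁ :=
  ⟨{ toFun := fun w => collar (fun v => l (w.1, v)) (fun z => δ (w.1, z)) w.2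
     continuous_toFun := continuous_collar hl hδ h
     map_zero_left := fun z => (h₀ z).symm
     map_one_left := fun z => (h₁ z).symm
     prop' := fun t z hz =>
       (collar_of_mem_boundary (fun v => l (t, v)) (fun z => δ (t, z)) hz).trans
         ((hx t).trans (γ₀.2 z hz).symm) }⟩

/-- A generalized loop is homotopic to its image under the end map of a homotopy starting at the
identity, after attaching the track of the base point as a collar. -/
lemma homotopic_collar_of_homotopy {x : X} {G : X × I → X} (hG : DeltaContinuous G)
    (h₀ : ∀ x, G (x, 0) = x) {γ γ' : GenLoop (Fin n) X x}
    (h : ∀ z, γ' z = collar (fun v => G (x, v)) (fun z => G (γ z, 1)) z) :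
    GenLoop.Homotopic γ γ' := by
  have hb : ∀ z ∈ Cube.boundary (Fin n), γ z = x := γ.2
  let γ₁ : GenLoop (Fin n) X x := ⟨⟨fun z => γ (cubeExpand 1 z),
    γ.1.continuous.comp (continuous_cubeExpand.comp (continuous_const.prodMk continuous_id))⟩,
    fun z hz => hb _ (cubeExpand_mem_boundary 1 hz)⟩
  have h1 : GenLoop.Homotopic γ γ₁ := homotopic_cubeExpand fun z => rfl
  -- At time `t` the collar follows the track of the base point only up to time `t`, matching `G (_,
  -- t)` on the inner cube.
  refine h1.trans (homotopic_of_eq_collar (l := fun w => G (x, w.2 * w.1))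
    (δ := fun w => G (γ w.2, w.1)) (hG.comp_continuous (by fun_prop))
    (hG.comp_continuous ((γ.1.continuous.comp continuous_snd).prodMk continuous_fst))
    (fun t z hz => by simp [hb z hz]) (fun t => by simp [h₀]) (fun z => ?_) fun z => ?_)
  · simp only [mul_zero, h₀]
    exact (collar_const hb z).symm
  · simp only [mul_one]
    exact h z

end Collar

open scoped unitInterval in
/-- A map with a homotopy inverse, whose homotopies are compatible with the map, is a weak
equivalence. The inverse and the homotopies need only be continuous on Euclidean test spaces. -/
theorem isWeakEquivalence_of_deltaContinuous {X Y : Type u} [TopologicalSpace X]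
    [TopologicalSpace Y] (f : C(X, Y)) {s : Y → X} {G : X × I → X} {K : Y × I → Y}
    (hs : DeltaContinuous s) (hG : DeltaContinuous G) (hK : DeltaContinuous K)
    (hG₀ : ∀ x, G (x, 0) = x) (hG₁ : ∀ x, G (x, 1) = s (f x))
    (hK₀ : ∀ y, K (y, 0) = y) (hK₁ : ∀ y, K (y, 1) = f (s y))
    (hf : ∀ x t, f (G (x, t)) = K (f x, t)) : IsWeakEquivalence f := by
  have hJG : ∀ x, Joined x (s (f x)) := fun x =>
    ⟨⟨⟨fun t => G (x, t), hG.comp_continuous (by fun_prop)⟩, hG₀ x, hG₁ x⟩⟩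
  have hJK : ∀ y, Joined y (f (s y)) := fun y =>
    ⟨⟨⟨fun t => K (y, t), hK.comp_continuous (by fun_prop)⟩, hK₀ y, hK₁ y⟩⟩
  refine ⟨⟨?_, ?_⟩, fun n x => ?_⟩
  · rintro ⟨x⟩ ⟨y⟩ h
    obtain ⟨p⟩ : Joined (f x) (f y) := Quotient.exact h
    refine Quotient.sound ((hJG x).trans (Joined.trans ⟨⟨⟨fun t => s (p t),
      hs.comp_continuous p.continuous⟩, ?_, ?_⟩⟩ (hJG y).symm)) <;> simp
  · rintro ⟨y⟩
    exact ⟨Quotient.mk _ (s y), Quotient.sound (hJK y).symm⟩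
  · have hsδ : ∀ (δ : GenLoop (Fin (n + 1)) Y (f x)), ∀ z ∈ Cube.boundary (Fin (n + 1)),
        s (δ z) = G (x, 1) := fun δ z hz => by
      rw [hG₁]
      exact congrArg s (δ.2 z hz)
    have hl : Continuous fun v : I => G (x, v) := hG.comp_continuous (by fun_prop)
    -- The inverse on homotopy groups: `s ∘ δ` is based at `s (f x)`, and the collar along `G (x,
    -- _)` brings it back to `x`.
    let κ (δ : GenLoop (Fin (n + 1)) Y (f x)) : GenLoop (Fin (n + 1)) X x :=
      ⟨⟨collar (fun v => G (x, v)) fun z => s (δ z),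
        (continuous_collar (Z := Unit) (l := fun w => G (x, w.2)) (δ := fun w => s (δ w.2))
          (hl.comp continuous_snd) ((hs.comp_continuous δ.1.continuous).comp continuous_snd)
          fun _ => hsδ δ).comp (f := fun z => ((), z)) (by fun_prop)⟩,
        fun z hz => (collar_of_mem_boundary (fun v => G (x, v)) (fun z => s (δ z)) hz).trans
          (hG₀ x)⟩
    have hκ : ∀ δ₀ δ₁, GenLoop.Homotopic δ₀ δ₁ → GenLoop.Homotopic (κ δ₀) (κ δ₁) := by
      rintro δ₀ δ₁ ⟨H⟩
      refine homotopic_of_eq_collar (l := fun w => G (x, w.2)) (δ := fun w => s (H w))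
        (hl.comp continuous_snd) (hs.comp_continuous H.continuous) (fun t z hz => ?_)
        (fun _ => hG₀ x) (fun z => ?_) fun z => ?_
      · rw [H.eq_fst t hz]
        exact hsδ δ₀ z hz
      · simp only [H.apply_zero]
        rfl
      · simp only [H.apply_one]
        rfl
    have hA : ∀ γ, GenLoop.Homotopic γ (κ (genLoopMap f (n + 1) x γ)) := fun γ =>
      homotopic_collar_of_homotopy hG hG₀ fun z => by
        simp only [hG₁]
        rfl
    -- By `hf`, the map `f` carries the collar along `G (x, _)` to the collar along `K (f x, _)`.
    have hB : ∀ δ, GenLoop.Homotopic δ (genLoopMap f (n + 1) x (κ δ)) := fun δ =>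
      homotopic_collar_of_homotopy hK hK₀ fun z => by
        simp only [hK₁, ← hf]
        exact apply_ite f _ _ _
    constructor
    · rintro ⟨γ₀⟩ ⟨γ₁⟩ h
      exact Quotient.sound ((hA γ₀).trans ((hκ _ _ (Quotient.exact h)).trans (hA γ₁).symm))
    · rintro ⟨δ⟩
      exact ⟨Quotient.mk _ (κ δ), Quotient.sound (hB δ).symm⟩

/-! ### Iterated collapses -/

section CollapseList

open scoped unitInterval
open StratTop

variable {P : Type u} [PartialOrder P] {X : StratSSet P} {I₀ : LTSeries P}

lemma ltSeries_le_iff {i j : Fin (I₀.length + 1)} : I₀ i ≤ I₀ j ↔ i ≤ j :=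
  I₀.strictMono.le_iff_le

/-- The successive collapses onto the parts below the elements of a regular flag. -/
def collapseList (L : List (Fin (I₀.length + 1))) (z : ((realization P).obj X).left)
    (t : Fin (I₀.length + 1) → I) : ((realization P).obj X).left :=
  L.foldr (fun j y => collapse X (I₀ j) (y, t j)) z

lemma continuous_collapseList (L : List (Fin (I₀.length + 1))) :
    Continuous fun w : ((realization P).obj X).left × (Fin (I₀.length + 1) → I) =>
      collapseList L w.1 w.2 := by
  induction L with
  | nil => exact continuous_fst
  | cons j L ih =>
    exact (collapse X (I₀ j)).continuous.comp
      (ih.prodMk ((continuous_apply j).comp continuous_snd))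

variable {L : List (Fin (I₀.length + 1))} {z : ((realization P).obj X).left}
  {t : Fin (I₀.length + 1) → I}

lemma collapse_mem_flagNeighborhood (j : Fin (I₀.length + 1)) (s : I)
    (hz : z ∈ flagNeighborhood (standardNeighborhood X) I₀) :
    collapse X (I₀ j) (z, s) ∈ flagNeighborhood (standardNeighborhood X) I₀ :=
  Set.mem_iInter.2 fun i => collapse_mem_standardNeighborhood _
    ((le_total i j).imp ltSeries_le_iff.2 ltSeries_le_iff.2) (Set.mem_iInter.1 hz i) s

lemma collapseList_mem (L : List (Fin (I₀.length + 1))) (t : Fin (I₀.length + 1) → I)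
    (hz : z ∈ flagNeighborhood (standardNeighborhood X) I₀) :
    collapseList L z t ∈ flagNeighborhood (standardNeighborhood X) I₀ := by
  induction L with
  | nil => exact hz
  | cons j L ih => exact collapse_mem_flagNeighborhood j (t j) ih

lemma collapseList_eq_self (h : ∀ j ∈ L, t j = 0 ∨ stratum _ z ≤ I₀ j) :
    collapseList L z t = z := by
  induction L with
  | nil => rfl
  | cons j L ih =>
    change collapse X (I₀ j) (collapseList L z t, t j) = z
    rw [ih fun i hi => h i (List.mem_cons_of_mem _ hi)]
    exact collapse_eq_self (h j List.mem_cons_self)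

/-- Only full collapses change strata, and one at `j` replaces the index `m'` of the stratum by `min
m' j`. Since all full collapses have `j ≥ k`, the index stays at least `k`, and it is `k` once `k`
has occurred. The order of the list plays no role. -/
lemma exists_stratum_collapseList (hz : z ∈ flagNeighborhood (standardNeighborhood X) I₀)
    {k m : Fin (I₀.length + 1)} (hm : stratum _ z = I₀ m) (hkm : k ≤ m)
    (ht : ∀ j ∈ L, t j = 1 → k ≤ j) :
    ∃ m', k ≤ m' ∧ stratum _ (collapseList L z t) = I₀ m' ∧
      ((m = k ∨ k ∈ L ∧ t k = 1) → m' = k) := by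
  induction L with
  | nil => exact ⟨m, hkm, hm, fun h => h.resolve_right fun h' => List.not_mem_nil h'.1⟩
  | cons j L ih =>
    obtain ⟨m', hkm', hm', h⟩ := ih fun i hi => ht i (List.mem_cons_of_mem _ hi)
    have hL := collapseList_mem L t hz
    change ∃ m', k ≤ m' ∧ stratum _ (collapse X (I₀ j) (collapseList L z t, t j)) = I₀ m' ∧ _
    by_cases hj : t j = 1
    · have hkj := ht j List.mem_cons_self hj
      by_cases hmj : m' ≤ j
      · rw [collapse_eq_self (Or.inr (hm'.trans_le (ltSeries_le_iff.2 hmj)))]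
        refine ⟨m', hkm', hm', ?_⟩
        rintro (h' | ⟨h', h''⟩)
        · exact h (Or.inl h')
        · rcases List.mem_cons.1 h' with rfl | h'
          · exact le_antisymm hmj hkm'
          · exact h (Or.inr ⟨h', h''⟩)
      · rw [hj, stratum_collapse_one (Set.mem_iInter.1 hL j)
          fun h' => hmj (ltSeries_le_iff.1 (hm'.symm.trans_le h'))]
        refine ⟨j, hkj, rfl, ?_⟩
        rintro (h' | ⟨h', h''⟩)
        · exact absurd ((h (Or.inl h')).trans_le hkj) hmj
        · rcases List.mem_cons.1 h' with rfl | h'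
          · rfl
          · exact absurd ((h (Or.inr ⟨h', h''⟩)).trans_le hkj) hmj
    · rw [stratum_collapse_of_ne_one _ _ hj]
      refine ⟨m', hkm', hm', fun h' => h (h'.imp_right fun h'' => ⟨?_, h''.2⟩)⟩
      exact (List.mem_cons.1 h''.1).resolve_left fun h3 => hj (h3 ▸ h''.2)

lemma stratum_collapseList (hz : z ∈ flagNeighborhood (standardNeighborhood X) I₀)
    {k m : Fin (I₀.length + 1)} (hm : stratum _ z = I₀ m) (hkm : k ≤ m)
    (ht : ∀ j ∈ L, t j = 1 → k ≤ j) (h : m = k ∨ k ∈ L ∧ t k = 1) :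
    stratum _ (collapseList L z t) = I₀ k := by
  obtain ⟨m', -, hm', h'⟩ := exists_stratum_collapseList hz hm hkm ht
  rw [hm', h' h]

end CollapseList

/-! ### Coordinates on the simplex -/

section Coordinates

open scoped unitInterval

variable {n : ℕ}

/-- The greatest vertex with positive coordinate. -/
def topVertex (x : stdSimplex ℝ (Fin (n + 1))) : Fin (n + 1) :=
  (Finset.univ.filter fun i => 0 < x i).max' (support_nonempty x)

lemma topVertex_pos (x : stdSimplex ℝ (Fin (n + 1))) : 0 < x (topVertex x) :=
  (Finset.mem_filter.1 (Finset.max'_mem _ (support_nonempty x))).2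

lemma le_topVertex {x : stdSimplex ℝ (Fin (n + 1))} {i : Fin (n + 1)} (hi : 0 < x i) :
    i ≤ topVertex x :=
  Finset.le_max' _ _ (by simp [hi])

/-- The sum of the coordinates up to a given vertex. -/
def partialSum (x : stdSimplex ℝ (Fin (n + 1))) (j : Fin (n + 1)) : I :=
  ⟨∑ i ∈ Finset.Iic j, x i, Finset.sum_nonneg fun i _ => stdSimplex.zero_le x i,
    (Finset.sum_le_univ_sum_of_nonneg (stdSimplex.zero_le x)).trans_eq (stdSimplex.sum_eq_one x)⟩

lemma continuous_partialSum : Continuous (partialSum (n := n)) := by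
  refine continuous_pi fun j => Continuous.subtype_mk (continuous_finsetSum _ fun i _ => ?_) _
  exact (continuous_apply i).comp continuous_subtype_val

/-- This is why partial sums serve as collapse times: the least index collapsed fully is the top
vertex of `x`. -/
lemma partialSum_eq_one_iff {x : stdSimplex ℝ (Fin (n + 1))} {j : Fin (n + 1)} :
    partialSum x j = 1 ↔ topVertex x ≤ j := by
  have h : partialSum x j = 1 ↔ ∑ i ∈ Finset.Iic j, x i = ∑ i, x i := by
    rw [stdSimplex.sum_eq_one, Subtype.ext_iff]
    rfl
  rw [h]
  constructor
  · intro h'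
    by_contra hj
    refine (Finset.sum_lt_sum_of_subset (Finset.subset_univ _) (Finset.mem_univ _)
      (by simpa using hj) (topVertex_pos x) fun i _ _ => stdSimplex.zero_le x i).ne h'
  · intro h'
    refine Finset.sum_subset (Finset.subset_univ _) fun i _ hi => ?_
    refine le_antisymm (not_lt.1 fun hi' => hi ?_) (stdSimplex.zero_le x i)
    exact Finset.mem_Iic.2 ((le_topVertex hi').trans h')

lemma partialSum_vertex_last {j : Fin (n + 1)} (hj : j ≠ Fin.last n) :
    partialSum (stdSimplex.vertex (Fin.last n)) j = 0 := by
  have h : ∑ i ∈ Finset.Iic j, stdSimplex.vertex (S := ℝ) (Fin.last n) i = 0 := by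
    refine Finset.sum_eq_zero fun i hi => ?_
    rw [stdSimplex.vertex_coe, Pi.single_eq_of_ne]
    rintro rfl
    exact hj (Fin.last_le_iff.1 (Finset.mem_Iic.1 hi))
  exact Subtype.ext h

/-- The straight line homotopy to the last vertex. -/
def toLast (x : stdSimplex ℝ (Fin (n + 1))) (a : I) : stdSimplex ℝ (Fin (n + 1)) :=
  ⟨(1 - (a : ℝ)) • x.1 + (a : ℝ) • (stdSimplex.vertex (S := ℝ) (Fin.last n)).1,
    convex_stdSimplex ℝ _ x.2 (stdSimplex.vertex (Fin.last n)).2 (sub_nonneg.2 a.2.2) a.2.1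
      (sub_add_cancel _ _)⟩

lemma continuous_toLast :
    Continuous fun w : stdSimplex ℝ (Fin (n + 1)) × I => toLast w.1 w.2 := by
  unfold toLast
  fun_prop

lemma toLast_zero (x : stdSimplex ℝ (Fin (n + 1))) : toLast x 0 = x := by
  refine Subtype.ext ?_
  simp [toLast]

lemma toLast_one (x : stdSimplex ℝ (Fin (n + 1))) :
    toLast x 1 = stdSimplex.vertex (Fin.last n) := by
  refine Subtype.ext ?_
  simp [toLast]

lemma toLast_vertex_last (a : I) :
    toLast (stdSimplex.vertex (Fin.last n)) a = stdSimplex.vertex (Fin.last n) := by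
  refine Subtype.ext ?_
  simp [toLast, ← add_smul]

lemma topVertex_toLast (x : stdSimplex ℝ (Fin (n + 1))) {a : I} (ha : 0 < a) :
    topVertex (toLast x a) = Fin.last n := by
  refine Fin.last_le_iff.1 (le_topVertex ?_)
  have h : toLast x a (Fin.last n) = (1 - (a : ℝ)) * x (Fin.last n) + a := by
    change ((1 - (a : ℝ)) • x.1 + (a : ℝ) • (stdSimplex.vertex (S := ℝ) (Fin.last n)).1) _ = _
    simp only [Pi.add_apply, Pi.smul_apply, smul_eq_mul, Pi.single_eq_same,
      mul_one]
    rfl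
  rw [h]
  have := mul_nonneg (sub_nonneg.2 a.2.2) (stdSimplex.zero_le x (Fin.last n))
  have ha' : (0 : ℝ) < a := ha
  linarith

end Coordinates

/-! ### Points of strata and of homotopy links of a subspace -/

section Restrict

open scoped unitInterval
open StratTop

variable {P : Type u} [PartialOrder P] {T : StratTop P} {A : Set T.left} {c : SpaceConvention}

/-- The point of a stratified space underlying a point of a stratum. -/
def strataVal {Q : Set P} (x : Strata T c Q) : T.left := (c.ofRefine x).1

lemma continuous_strataVal {Q : Set P} : Continuous (strataVal (T := T) (c := c) (Q := Q)) :=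
  continuous_subtype_val.comp (c.continuous_ofRefine {x : T.left // stratum T x ∈ Q})

/-- The point of the subspace underlying a point of a stratum. -/
def strataPoint {Q : Set P} (x : Strata (restrict T c A) c Q) : A :=
  c.ofRefine (X := A) (strataVal x)

lemma continuous_strataPoint {Q : Set P} :
    Continuous (strataPoint (T := T) (A := A) (c := c) (Q := Q)) :=
  (c.continuous_ofRefine A).comp (continuous_strataVal (T := restrict T c A))

lemma stratum_strataPoint {Q : Set P} (x : Strata (restrict T c A) c Q) :
    stratum T (strataPoint x).1 ∈ Q :=
  (c.ofRefine x).2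

/-- A point of a stratum of a subspace. -/
def strataMk {Q : Set P} (a : A) (h : stratum T a.1 ∈ Q) : Strata (restrict T c A) c Q :=
  c.toRefine (X := {x : (restrict T c A).left // stratum (restrict T c A) x ∈ Q})
    ⟨c.toRefine a, h⟩

lemma strata_ext {Q : Set P} {x y : Strata (restrict T c A) c Q}
    (h : (strataPoint x).1 = (strataPoint y).1) : x = y :=
  Subtype.ext (Subtype.ext h)

lemma deltaContinuous_strataMk {Z : Type*} [TopologicalSpace Z] {Q : Set P} {f : Z → A}
    (hf : DeltaContinuous f) (h : ∀ z, stratum T (f z).1 ∈ Q) :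
    DeltaContinuous fun z => strataMk (c := c) (f z) (h z) :=
  (c.deltaContinuous_toRefine _).comp
    (((c.deltaContinuous_toRefine A).comp hf).subtype_mk
      (p := fun x : (restrict T c A).left => stratum (restrict T c A) x ∈ Q) h)

variable {I₀ : LTSeries P}

/-- The value of a point of a homotopy link at a point of the simplex. -/
def linkEval (f : HomotopyLink (restrict T c A) c I₀)
    (x : stdSimplex ℝ (Fin (I₀.length + 1))) : A :=
  c.ofRefine ((c.ofRefine f).1 x)

lemma continuous_linkEval :
    Continuous fun w : HomotopyLink (restrict T c A) c I₀ × stdSimplex ℝ (Fin (I₀.length + 1)) =>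
      linkEval w.1 w.2 := by
  have h : Continuous fun w : HomotopyLink (restrict T c A) c I₀ ×
      stdSimplex ℝ (Fin (I₀.length + 1)) => (c.ofRefine w.1).1 w.2 :=
    ContinuousEval.continuous_eval.comp (((continuous_subtype_val.comp
      (c.continuous_ofRefine (StratMap (flag I₀) (restrict T c A)))).comp continuous_fst).prodMk
        continuous_snd)
  exact (c.continuous_ofRefine A).comp h

lemma stratum_linkEval (f : HomotopyLink (restrict T c A) c I₀)
    (x : stdSimplex ℝ (Fin (I₀.length + 1))) :
    stratum T (linkEval f x).1 = I₀ (topVertex x) :=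
  (c.ofRefine f).2 x

/-- The point of a homotopy link given by a continuous map. -/
def linkMk (f : stdSimplex ℝ (Fin (I₀.length + 1)) → A) (hf : Continuous f)
    (h : ∀ x, stratum T (f x).1 = I₀ (topVertex x)) : HomotopyLink (restrict T c A) c I₀ :=
  c.toRefine (X := StratMap (flag I₀) (restrict T c A))
    ⟨⟨fun x => c.toRefine (f x), (c.deltaContinuous_toRefine A).comp_continuous hf⟩, h⟩

lemma link_ext {f g : HomotopyLink (restrict T c A) c I₀}
    (h : ∀ x, (linkEval f x).1 = (linkEval g x).1) : f = g :=
  Subtype.ext (ContinuousMap.ext fun x => Subtype.ext (h x))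

lemma deltaContinuous_linkMk {Z : Type*} [TopologicalSpace Z]
    {f : Z → stdSimplex ℝ (Fin (I₀.length + 1)) → A}
    (hf : Continuous fun w : Z × stdSimplex ℝ (Fin (I₀.length + 1)) => f w.1 w.2)
    (h : ∀ z x, stratum T (f z x).1 = I₀ (topVertex x)) :
    DeltaContinuous fun z => linkMk (c := c) (f z) (by fun_prop) (h z) := by
  refine (c.deltaContinuous_toRefine (StratMap (flag I₀) (restrict T c A))).comp
    (DeltaContinuous.subtype_mk (p := fun g : C(stdSimplex ℝ (Fin (I₀.length + 1)),
      (restrict T c A).left) => ∀ x, stratum (restrict T c A) (g x) = simplexStratum (flag I₀) x)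
      ?_ h)
  exact DeltaContinuous.curry ((c.deltaContinuous_toRefine A).comp hf.deltaContinuous)
    fun _ _ => rfl

end Restrict

/-! ### The weak equivalences -/

section Main

open scoped unitInterval
open StratTop

variable {P : Type u} [PartialOrder P] (c : SpaceConvention) (X : StratSSet P) (I₀ : LTSeries P)

theorem isWeakEquivalence_strataInclusion :
    IsWeakEquivalence (strataInclusion (restrict ((realization P).obj X) c
      (flagNeighborhood (standardNeighborhood X) I₀)) c
        (Set.singleton_subset_iff.2 Set.self_mem_Ici : {I₀.last} ⊆ Set.Ici I₀.last)) := by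
  let T := (realization P).obj X
  let A : Set T.left := flagNeighborhood (standardNeighborhood X) I₀
  let F (w : Strata (restrict T c A) c (Set.Ici I₀.last) × I) : A :=
    ⟨collapse X I₀.last ((strataPoint w.1).1, w.2),
      collapse_mem_flagNeighborhood (Fin.last _) w.2 (strataPoint w.1).2⟩
  have hF : Continuous F := by
    refine Continuous.subtype_mk ((collapse X I₀.last).continuous.comp ?_) _
    exact (continuous_subtype_val.comp (continuous_strataPoint.comp continuous_fst)).prodMk
      continuous_snd
  have hF₁ : ∀ y, stratum T (F (y, 1)).1 = I₀.last := fun y => by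
    have hy : I₀.last ≤ stratum T (strataPoint y).1 := stratum_strataPoint y
    by_cases h : stratum T (strataPoint y).1 ≤ I₀.last
    · exact (congrArg (stratum T) (collapse_eq_self (Or.inr h))).trans (le_antisymm h hy)
    · exact stratum_collapse_one (Set.mem_iInter.1 (strataPoint y).2 (Fin.last _)) h
  have hF₂ : ∀ w, stratum T (F w).1 ∈ Set.Ici I₀.last := fun w => by
    by_cases h : w.2 = 1
    · have h' := hF₁ w.1
      rw [← h] at h'
      exact h'.ge
    · exact (stratum_strataPoint w.1).trans_eq (stratum_collapse_of_ne_one I₀.last _ h).symm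
  -- The collapse fixes the stratum `p_n` pointwise, so the homotopy on the source is constant.
  refine isWeakEquivalence_of_deltaContinuous _ (s := fun y => strataMk (F (y, 1)) (hF₁ y))
    (G := Prod.fst) (K := fun w => strataMk (F w) (hF₂ w)) (deltaContinuous_strataMk
      (Continuous.deltaContinuous (by fun_prop)) hF₁) continuous_fst.deltaContinuous
    (deltaContinuous_strataMk hF.deltaContinuous hF₂) (fun _ => rfl) (fun x => ?_) (fun y => ?_)
    (fun _ => rfl) fun x t => ?_
  · exact strata_ext (collapse_eq_self (Or.inr (le_of_eq (stratum_strataPoint x)))).symm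
  · exact strata_ext (collapse_eq_self (Or.inl rfl))
  · exact strata_ext (collapse_eq_self (Or.inr (le_of_eq (stratum_strataPoint x)))).symm

theorem isWeakEquivalence_evLast :
    IsWeakEquivalence (evLast (restrict ((realization P).obj X) c
      (flagNeighborhood (standardNeighborhood X) I₀)) c I₀) := by
  let T := (realization P).obj X
  let A : Set T.left := flagNeighborhood (standardNeighborhood X) I₀
  let L := List.finRange (I₀.length + 1)
  let F (z : A) (t : Fin (I₀.length + 1) → I) : A :=
    ⟨collapseList L z.1 t, collapseList_mem L t z.2⟩
  have hF : Continuous fun w : A × (Fin (I₀.length + 1) → I) => F w.1 w.2 :=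
    ((continuous_collapseList L).comp
      ((continuous_subtype_val.comp continuous_fst).prodMk continuous_snd)).subtype_mk _
  -- Two-stage clocks: `b` turns on the collapses in the first half, `a` slides to the last vertex
  -- in the second. Sliding raises the stratum at once, so the collapses must be fully on before it
  -- begins (`hab`).
  let a (t : I) : I := Set.projIcc 0 1 zero_le_one (2 * (t : ℝ) - 1)
  let b (t : I) : I := Set.projIcc 0 1 zero_le_one (2 * (t : ℝ))
  have ha : Continuous a := by fun_prop
  have hb : Continuous b := by fun_prop
  have ha₀ : a 0 = 0 := (Set.projIcc_eq_left zero_lt_one).2 (by simp)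
  have ha₁ : a 1 = 1 := (Set.projIcc_eq_right zero_lt_one).2 (by norm_num)
  have hb₀ : b 0 = 0 := (Set.projIcc_eq_left zero_lt_one).2 (by simp)
  have hb₁ : b 1 = 1 := (Set.projIcc_eq_right zero_lt_one).2 (by norm_num)
  have hab : ∀ t, a t = 0 ∨ 0 < a t ∧ b t = 1 := fun t => by
    rcases le_total (2 * (t : ℝ)) 1 with h | h
    · exact Or.inl ((Set.projIcc_eq_left zero_lt_one).2 (by linarith))
    · refine (eq_or_ne (a t) 0).imp_right fun h' => ⟨unitInterval.pos_iff_ne_zero.2 h', ?_⟩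
      exact (Set.projIcc_eq_right zero_lt_one).2 h
  have hmul : ∀ s t : I, s * t = 1 → t = 1 := fun s t h =>
    le_antisymm unitInterval.le_one' (h ▸ unitInterval.mul_le_right)
  -- At the last vertex every collapse time but the last is 0, and the last collapse fixes the
  -- stratum `p_n`. So evaluation undoes the section and is constant along the homotopy.
  have hself : ∀ (z : A) (s : I), stratum T z.1 = I₀.last → (F z fun j =>
      s * partialSum (stdSimplex.vertex (Fin.last I₀.length)) j).1 = z.1 := fun z s hz =>
    collapseList_eq_self fun j _ => by
      by_cases hj : j = Fin.last _
      · exact Or.inr (hz.trans_le (hj ▸ le_rfl))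
      · exact Or.inl (by rw [partialSum_vertex_last hj, mul_zero])
  have hlast : topVertex (stdSimplex.vertex (S := ℝ) (Fin.last I₀.length)) = Fin.last _ :=
    Fin.last_le_iff.1 (le_topVertex (by simp))
  let S (y : Strata (restrict T c A) c {I₀.last}) (x : stdSimplex ℝ (Fin (I₀.length + 1))) : A :=
    F (strataPoint y) fun j => 1 * partialSum x j
  have hS : Continuous fun w : Strata (restrict T c A) c {I₀.last} ×
      stdSimplex ℝ (Fin (I₀.length + 1)) => S w.1 w.2 :=
    hF.comp ((continuous_strataPoint.comp continuous_fst).prodMk (continuous_pi fun j =>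
      continuous_const.mul ((continuous_apply j).comp (continuous_partialSum.comp continuous_snd))))
  have hSs : ∀ y x, stratum T (S y x).1 = I₀ (topVertex x) := fun y x => by
    refine stratum_collapseList (strataPoint y).2 (m := Fin.last _) (stratum_strataPoint y)
      (Fin.le_last _) (fun j _ h => ?_) (Or.inr ⟨List.mem_finRange _, ?_⟩)
    · exact partialSum_eq_one_iff.1 (hmul _ _ h)
    · rw [one_mul, partialSum_eq_one_iff]
  let G (w : HomotopyLink (restrict T c A) c I₀ × I) (x : stdSimplex ℝ (Fin (I₀.length + 1))) :
      A := F (linkEval w.1 (toLast x (a w.2))) fun j => b w.2 * partialSum x j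
  have hG : Continuous fun w : (HomotopyLink (restrict T c A) c I₀ × I) ×
      stdSimplex ℝ (Fin (I₀.length + 1)) => G w.1 w.2 := by
    refine hF.comp (Continuous.prodMk ?_ (continuous_pi fun j => ?_))
    · exact continuous_linkEval.comp ((continuous_fst.comp continuous_fst).prodMk
        (continuous_toLast.comp (continuous_snd.prodMk
          (ha.comp (continuous_snd.comp continuous_fst)))))
    · exact (hb.comp (continuous_snd.comp continuous_fst)).mul
        ((continuous_apply j).comp (continuous_partialSum.comp continuous_snd))
  have hGs : ∀ w x, stratum T (G w x).1 = I₀ (topVertex x) := fun w x => by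
    have h1 : ∀ j ∈ L, b w.2 * partialSum x j = 1 → topVertex x ≤ j := fun j _ h =>
      partialSum_eq_one_iff.1 (hmul _ _ h)
    refine stratum_collapseList (linkEval w.1 _).2 (stratum_linkEval w.1 _) ?_ h1 ?_
    -- While `a = 0`, the link value already lies in the stratum of the top vertex of `x`, which no
    -- full collapse changes. Afterwards it lies in the stratum `p_n`, and the full collapse at the
    -- top vertex brings it down.
    · rcases hab w.2 with h | ⟨h, -⟩
      · rw [h, toLast_zero]
      · rw [topVertex_toLast x h]
        exact Fin.le_last _
    · rcases hab w.2 with h | ⟨h, h'⟩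
      · rw [h, toLast_zero]
        exact Or.inl rfl
      · refine Or.inr ⟨List.mem_finRange _, ?_⟩
        rw [h', one_mul, partialSum_eq_one_iff]
  have hev : ∀ f : HomotopyLink (restrict T c A) c I₀,
      stratum T (linkEval f (stdSimplex.vertex (Fin.last I₀.length))).1 = I₀.last := fun f => by
    rw [stratum_linkEval, hlast]
    rfl
  refine isWeakEquivalence_of_deltaContinuous _
    (s := fun y => linkMk (S y) (by fun_prop) (hSs y))
    (G := fun w => linkMk (G w) (by fun_prop) (hGs w)) (K := Prod.fst)
    (deltaContinuous_linkMk hS hSs) (deltaContinuous_linkMk hG hGs)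
    continuous_fst.deltaContinuous (fun f => link_ext fun x => ?_)
    (fun f => link_ext fun x => ?_) (fun _ => rfl) (fun y => strata_ext ?_)
    fun f t => strata_ext ?_
  · change collapseList L (linkEval f (toLast x (a 0))).1 (fun j => b 0 * partialSum x j) = _
    rw [ha₀, hb₀, toLast_zero]
    exact collapseList_eq_self fun j _ => Or.inl (zero_mul _)
  · change (F (linkEval f (toLast x (a 1))) fun j => b 1 * partialSum x j).1 = _
    rw [ha₁, hb₁, toLast_one]
    rfl
  · exact (hself _ 1 (stratum_strataPoint y)).symm
  · change (F (linkEval f (toLast (stdSimplex.vertex (Fin.last _)) (a t))) fun j =>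
      b t * partialSum (stdSimplex.vertex (Fin.last _)) j).1 = _
    rw [toLast_vertex_last]
    exact hself _ (b t) (hev f)

end Main

end

end StratifiedLinks

/-- The standard neighborhood system of the realization of a stratified simplicial set is a
homotopy link model, in each of the three categories of topological spaces. -/
theorem mainTheorem7 {P : Type u} [PartialOrder P] (c : StratifiedLinks.SpaceConvention)
    (X : StratifiedLinks.StratSSet P) :
    StratifiedLinks.StratTop.IsHomotopyLinkModel ((StratifiedLinks.realization P).obj X) c
      (StratifiedLinks.standardNeighborhood X) :=
  ⟨StratifiedLinks.isStrataNeighborhoodSystem_standardNeighborhood X, fun I₀ =>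
    ⟨StratifiedLinks.isWeakEquivalence_evLast c X I₀,
      StratifiedLinks.isWeakEquivalence_strataInclusion c X I₀⟩⟩
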